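/- Let $d\ge 1$ and $k\ge 2$ be integers and let $\Omega\subset\mathbb{R}^d$ be a non-empty bounded open set (for instance a bounded connected Lipschitz domain). For $N\in\mathbb{N}_0$, write $\mathrm{x}=(\mathbf{x}_1,\dots,\mathbf{x}_N)\in(\mathbb{R}^d)^N$ and let $\triangle_k$ be the set of those $\mathrm{x}$ with $\mathbf{x}_{j_1}=\dots=\mathbf{x}_{j_k}$ for some distinct indices $j_1,\dots,j_k$. For real $s=m+\sigma>0$ with $m\in\mathbb{N}_0$, $0\le\sigma<1$, put $$\|u\|_{\dot H^{s,N}(\Omega)}^2:=\sum_{j=1}^N\int_{\Omega^{N-1}}\|u\|_{\dot H^s_{\mathbf{x}_j}(\Omega)}^2\prod_{\ell\ne j}d\mathbf{x}_\ell ,$$ where, for a function $f$ on $\Omega$, $\|f\|_{\dot H^s(\Omega)}^2=\sum_{|\alpha|=m}\frac{m!}{\alpha!}\int_\Omega|D^\alpha f|^2$ if $\sigma=0$, and $\|f\|_{\dot H^s(\Omega)}^2=c_{d,\sigma}\sum_{|\alpha|=m}\frac{m!}{\alpha!}\iint_{\Omega\times\Omega}\frac{|D^\alpha f(\mathbf{x})-D^\alpha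 f(\mathbf{y})|^2}{|\mathbf{x}-\mathbf{y}|^{d+2\sigma}}\,d\mathbf{x}\,d\mathbf{y}$ with $c_{d,\sigma}=\frac{2^{2\sigma-1}}{\pi^{d/2}}\frac{\Gamma((d+2\sigma)/2)}{|\Gamma(-\sigma)|}$ if $\sigma>0$. Let $H^s(\mathbb{R}^{dN})$ have the norm $\|\Psi\|_{H^s}^2=\|\Psi\|_{L^2}^2+\langle\Psi,(-\Delta)^s\Psi\rangle$, and let $$\mathcal{H}_{0,k}^{s,N}:=\overline{C_c^\infty(\mathbb{R}^{dN}\setminus\triangle_k)}^{\,H^s(\mathbb{R}^{dN})},\qquad \mathcal{H}_{W,k}^{s,N}:=\Bigl\{\Psi\in H^s(\mathbb{R}^{dN}):\int_{\mathbb{R}^{dN}}W_{s,k}|\Psi|^2<\infty\Bigr\},$$ $$W_{s,k}(\mathrm{x}):=\sum_{A\subseteq\{1,\dots,N\},\,|A|=k}\Bigl(\sum_{j,l\in A,\,j<l}|\mathbf{x}_j-\mathbf{x}_l|^2\Bigr)^{-s}.$$ For a class $\mathcal{C}$ of complex-valued functions $u\in C^\infty(\Omega^N)$, say that the many-body Poincaré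 inequality holds on $\mathcal{C}$ if there is a constant $C>0$ with $\|u\|_{\dot H^{s,N}(\Omega)}\ge C\|u\|_{L^2(\Omega^N)}$ for all $u\in\mathcal{C}$. Assume that either (i) $N<k$ and $s>0$ is real; or (ii) $N=k$, $s$ is an integer and $\max\{d,2\}(k-1)<2s<(d+k)(k-1)$. Then the many-body Poincaré inequality does not hold on the class of those $u\in C^\infty(\Omega^N)$ that vanish on $\Omega^N\cap\triangle_k$. It also does not hold on the class of those $u\in C^\infty(\Omega^N)$ that are the restriction to $\Omega^N$ of an element of $\mathcal{H}_{0,k}^{s,N}$, nor on the class of those that are the restriction of an element of $\mathcal{H}_{W,k}^{s,N}$. Explicitly, let $u\equiv 1$ in case (i) and $u(\mathrm{x})=\prod_{1\le j<l\le k}(x_{j,1}-x_{l,1})$ in case (ii), where $x_{j,1}$ is the first coordinate of $\mathbf{x}_j$. Then $u$ vanishes on $\Omega^N\cap\triangle_k$, it is on $\Omega^N$ the restriction of an element of $\mathcal{H}_{0,k}^{s,N}\cap\mathcal{H}_{W,k}^{s,N}$, and $\|u\|_{\dot H^{s,N}(\Omega)}=0$ while $0<\|u\|_{L^2(\Omega^N)}<\infty$.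 -/

import Mathlib

open MeasureTheory
open scoped ENNReal ContDiff FourierTransform

noncomputable section

namespace ManyBody

/-- The one-particle space `ℝ^d` with its Euclidean norm. -/
abbrev Pt (d : ℕ) := EuclideanSpace ℝ (Fin d)

/-- The configuration space `(ℝ^d)^N = ℝ^{dN}` with its Euclidean norm and Lebesgue measure; the
position of the `j`-th particle in the configuration `x` is `x j`. -/
abbrev Config (d N : ℕ) := PiLp 2 (fun _ : Fin N => Pt d)

/-- The set `Ω^N` of configurations with all particles in `Ω`. -/
def box {d : ℕ} (N : ℕ) (Ω : Set (Pt d)) : Set (Config d N) := {x | ∀ j, x j ∈ Ω}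

/-- The diagonal set of `k`-particle coincidences: the configurations in which the particles
with labels in some `k`-element set `A` all sit at the same point. -/
def diagonal (d N k : ℕ) : Set (Config d N) :=
  {x | ∃ A : Finset (Fin N), A.card = k ∧ ∀ i ∈ A, ∀ j ∈ A, x i = x j}

/-- The partial derivative of `f` in the `i`-th coordinate direction of `ℝ^d`. -/
def partialDeriv {d : ℕ} (i : Fin d) (f : Pt d → ℂ) : Pt d → ℂ :=
  fun y => lineDeriv ℝ f y (EuclideanSpace.single i 1)

/-- The derivative `D^α f` for a multi-index `α`: for every coordinate direction `i`, the
partial derivative in that direction is taken `α i` times. -/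
def multiDeriv {d : ℕ} (α : Fin d → ℕ) (f : Pt d → ℂ) : Pt d → ℂ :=
  (List.finRange d).foldr (fun i g => (partialDeriv i)^[α i] g) f

/-- The multi-indices `α ∈ ℕ^d` with `|α| = m`. -/
def multiIndices (d m : ℕ) : Finset (Fin d → ℕ) := Finset.piAntidiag Finset.univ m

/-- The normalization constant
`c_{d,σ} = 2^{2σ-1} π^{-d/2} Γ((d+2σ)/2) / |Γ(-σ)|` of the fractional seminorm. -/
def fracConst (d : ℕ) (σ : ℝ) : ℝ :=
  2 ^ (2 * σ - 1) / Real.pi ^ ((d : ℝ) / 2) * (Real.Gamma ((d + 2 * σ) / 2) / |Real.Gamma (-σ)|)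

/-- The square of the homogeneous one-particle Sobolev seminorm of order `s = m + σ`
(`m` integer, `0 ≤ σ < 1`) on `Ω ⊆ ℝ^d`, with values in `[0,∞]`. The coefficient
`Nat.multinomial Finset.univ α` is `m!/α!`. -/
def seminormSq {d : ℕ} (s : ℝ) (Ω : Set (Pt d)) (f : Pt d → ℂ) : ℝ≥0∞ :=
  if Int.fract s = 0 then
    ∑ α ∈ multiIndices d ⌊s⌋₊, (Nat.multinomial Finset.univ α : ℝ≥0∞) *
      ∫⁻ x in Ω, ‖multiDeriv α f x‖ₑ ^ 2
  else
    ENNReal.ofReal (fracConst d (Int.fract s)) *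
      ∑ α ∈ multiIndices d ⌊s⌋₊, (Nat.multinomial Finset.univ α : ℝ≥0∞) *
        ∫⁻ x in Ω, ∫⁻ y in Ω, ENNReal.ofReal
          (‖multiDeriv α f x - multiDeriv α f y‖ ^ 2 / ‖x - y‖ ^ ((d : ℝ) + 2 * Int.fract s))

/-- The configuration in which particle `j` sits at `y` and the others at the positions `x'`. -/
def insertAt {d N : ℕ} (j : Fin N) (y : Pt d) (x' : {i : Fin N // i ≠ j} → Pt d) : Config d N :=
  WithLp.toLp 2 fun i => if h : i = j then y else x' ⟨i, h⟩

/-- The `N`-particle seminorm on `Ω^N`, where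
`‖u‖² = ∑_j ∫_{Ω^{N-1}} ‖u(x_1, …, x_{j-1}, · , x_{j+1}, …, x_N)‖²` with the one-particle
seminorm of order `s` in the variable `x_j ∈ Ω` inside the integral. -/
def manySeminorm {d N : ℕ} (s : ℝ) (Ω : Set (Pt d)) (u : Config d N → ℂ) : ℝ≥0∞ :=
  (∑ j : Fin N, ∫⁻ x' in Set.univ.pi (fun _ : {i : Fin N // i ≠ j} => Ω),
    seminormSq s Ω (fun y => u (insertAt j y x'))) ^ (1 / 2 : ℝ)

/-- The norm of `u` in `L²(Ω^N)`, with values in `[0,∞]`. -/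
def boxNorm {d N : ℕ} (Ω : Set (Pt d)) (u : Config d N → ℂ) : ℝ≥0∞ :=
  eLpNorm u 2 (volume.restrict (box N Ω))

/-- The complex space `L²(ℝ^{dN})`. -/
abbrev L2 (d N : ℕ) := Lp ℂ 2 (volume : Measure (Config d N))

/-- The square of the `H^s(ℝ^{dN})`-norm, `‖Ψ‖² + ⟨Ψ, (-Δ)^s Ψ⟩`, with values in `[0,∞]`.
As `𝓕` is normalized with the kernel `exp (-2πi ⟨x, ξ⟩)`, the symbol of `(-Δ)^s` at `ξ` is
`‖2πξ‖^{2s}`. -/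
def sobolevNormSq {d N : ℕ} (s : ℝ) (Ψ : L2 d N) : ℝ≥0∞ :=
  ∫⁻ ξ : Config d N, ENNReal.ofReal (1 + (2 * Real.pi * ‖ξ‖) ^ (2 * s)) *
    ‖(𝓕 Ψ : L2 d N) ξ‖ₑ ^ 2

/-- The Sobolev space `H^s(ℝ^{dN})`. -/
def sobolevSpace (d N : ℕ) (s : ℝ) : Set (L2 d N) := {Ψ | sobolevNormSq s Ψ < ⊤}

/-- The hard-core space `H_{0,k}^{s,N}(ℝ^d)`: the closure in `H^s(ℝ^{dN})` of the smooth
functions with compact support in the complement of the `k`-particle diagonals. -/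
def hardCoreSpace (d N k : ℕ) (s : ℝ) : Set (L2 d N) :=
  {Ψ | Ψ ∈ sobolevSpace d N s ∧ ∀ ε : ℝ≥0∞, 0 < ε → ∃ φ : Config d N → ℂ,
    ContDiff ℝ ∞ φ ∧ HasCompactSupport φ ∧ tsupport φ ⊆ (diagonal d N k)ᶜ ∧
      ∃ hφ : MemLp φ 2 (volume : Measure (Config d N)), sobolevNormSq s (Ψ - hφ.toLp φ) < ε}

/-- The `k`-particle potential
`W_{s,k}(x) = ∑_{|A| = k} (∑_{j < l in A} |x_j - x_l|²)^{-s}`, with values in `[0,∞]`. -/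
def potential {d N : ℕ} (k : ℕ) (s : ℝ) (x : Config d N) : ℝ≥0∞ :=
  ∑ A ∈ Finset.powersetCard k (Finset.univ : Finset (Fin N)),
    (ENNReal.ofReal (∑ j ∈ A, ∑ l ∈ A with j < l, ‖x j - x l‖ ^ 2)) ^ (-s)

/-- The form domain `H_{W,k}^{s,N}(ℝ^d)`: the `Ψ ∈ H^s(ℝ^{dN})` with `∫ W_{s,k} |Ψ|² < ∞`. -/
def potentialSpace (d N k : ℕ) (s : ℝ) : Set (L2 d N) :=
  {Ψ | Ψ ∈ sobolevSpace d N s ∧ ∫⁻ x : Config d N, potential k s x * ‖Ψ x‖ₑ ^ 2 < ⊤}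

/-- The functions `u ∈ C^∞(Ω^N)` that vanish on the `k`-particle diagonals inside `Ω^N`. -/
def vanishingClass {d : ℕ} (N k : ℕ) (Ω : Set (Pt d)) : Set (Config d N → ℂ) :=
  {u | ContDiffOn ℝ ∞ u (box N Ω) ∧ ∀ x ∈ box N Ω ∩ diagonal d N k, u x = 0}

/-- The functions `u ∈ C^∞(Ω^N)` that are the restriction to `Ω^N` of a member of `V`. -/
def restrictionClass {d N : ℕ} (Ω : Set (Pt d)) (V : Set (L2 d N)) : Set (Config d N → ℂ) :=
  {u | ContDiffOn ℝ ∞ u (box N Ω) ∧ ∃ Ψ ∈ V, ∀ᵐ x ∂volume.restrict (box N Ω), Ψ x = u x}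

/-- The many-body Poincaré inequality on `Ω^N` for the functions of a class `𝒞`:
`‖u‖_{Ḣ^{s,N}(Ω)} ≥ C ‖u‖_{L²(Ω^N)}` for all `u ∈ 𝒞`, for some constant `C > 0`. -/
def PoincareInequality {d N : ℕ} (s : ℝ) (Ω : Set (Pt d)) (𝒞 : Set (Config d N → ℂ)) : Prop :=
  ∃ C : ℝ, 0 < C ∧ ∀ u ∈ 𝒞, ENNReal.ofReal C * boxNorm Ω u ≤ manySeminorm s Ω u

/-- `u` is a counterexample to the inequality, under each of the three vanishing conditions at
once: it is in all three classes, and it is a non-zero element of `L²(Ω^N)` of zero seminorm. -/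
def IsCounterexample {d N : ℕ} (k : ℕ) (s : ℝ) (Ω : Set (Pt d)) (u : Config d N → ℂ) : Prop :=
  u ∈ vanishingClass N k Ω ∧
  u ∈ restrictionClass Ω (hardCoreSpace d N k s ∩ potentialSpace d N k s) ∧
  boxNorm Ω u ≠ 0 ∧ boxNorm Ω u ≠ ⊤ ∧ manySeminorm s Ω u = 0

/-- The product `∏_{j < l} (x_{j,1} - x_{l,1})` of the differences of the first coordinates of
the particles. -/
def differenceProduct {d N : ℕ} [NeZero d] (x : Config d N) : ℂ :=
  ∏ j : Fin N, ∏ l ∈ Finset.Ioi j, ((x j 0 - x l 0 : ℝ) : ℂ)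

end ManyBody

end

noncomputable section

namespace ManyBody

/-! A nonzero function of zero seminorm that lies in all three classes defeats every constant `C`,
so the task is to exhibit one and to check membership.

If `N < k`, there are no `k`-particle coincidences and `W` is an empty sum. The constant 1,
multiplied by a cutoff equal to 1 on `Ω^N`, does the job.

If `N = k = K + 1`, let `u` be the Vandermonde product in the first coordinates. In each particle
separately it is a polynomial of degree at most `K`. The hypothesis `2 (k - 1) < 2 s` gives `K < m =
s`, so all one-particle derivatives of order `m` vanish (`seminormSq_eval_eq_zero`,
`exists_eval_differenceProduct_insertAt`).

Membership in the two spaces is a matter of scaling. The function `u` is translation invariant and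
homogeneous of degree `p = K (K + 1) / 2`, and the diagonal has codimension `d K`. At distance `δ`
from the diagonal, derivatives up to order `m` of `u` cut off at that scale have size `δ^(p - m)`,
on a set of volume `δ^(d K)` (`exists_volume_tube_le`). Their squared norm is therefore of order
`δ^(2 p + d K - 2 m)`, which tends to 0 exactly because `2 m < (d + k) (k - 1) = 2 p + d K`. Hence
the part of `χ u` near the diagonal can be removed at arbitrarily small cost in `H^m`
(`exists_sobolevNormSq_dilate_lt`, `toLp_mem_hardCoreSpace`). The same exponent makes `∫ W |χ u|²`
converge, dyadically in the distance to the diagonal (`lintegral_potential_mul_lt_top`). -/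

/-! ### Sobolev norms of test functions, bounded by `L²` norms of derivatives. -/

open SchwartzMap LineDeriv in
theorem fourier_iteratedLineDerivOp_const {V : Type*} [NormedAddCommGroup V]
    [InnerProductSpace ℝ V] [FiniteDimensional ℝ V] [MeasurableSpace V] [BorelSpace V]
    (f : 𝓢(V, ℂ)) (v : V) (m : ℕ) (ξ : V) :
    𝓕 (∂^{fun _ : Fin m => v} f) ξ
      = (2 * Real.pi * Complex.I * (inner ℝ ξ v : ℝ)) ^ m * 𝓕 f ξ := by
  induction m with
  | zero => simp
  | succ n ih =>
    have hg : (fun x : V => inner ℝ x v).HasTemperateGrowth :=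
      ((innerSL ℝ).flip v).hasTemperateGrowth
    rw [iteratedLineDerivOp_succ_left, fourier_lineDerivOp_eq]
    change (2 * Real.pi * Complex.I) • (smulLeftCLM ℂ (fun x : V => inner ℝ x v)
      (𝓕 (∂^{fun _ : Fin n => v} f))) ξ = _
    rw [smulLeftCLM_apply_apply hg, ih]
    simp only [smul_eq_mul, Complex.real_smul]
    ring

theorem lintegral_enorm_sq_fourier {V : Type*} [NormedAddCommGroup V]
    [InnerProductSpace ℝ V] [FiniteDimensional ℝ V] [MeasurableSpace V] [BorelSpace V]
    (f : SchwartzMap V ℂ) : ∫⁻ ξ, ‖𝓕 f ξ‖ₑ ^ 2 = ∫⁻ x, ‖f x‖ₑ ^ 2 := by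
  have key (g : SchwartzMap V ℂ) : ∫⁻ x, ‖g x‖ₑ ^ 2 = ENNReal.ofReal (∫ x, ‖g x‖ ^ 2) := by
    rw [ofReal_integral_eq_lintegral_ofReal (g.memLp 2 volume).norm.integrable_sq
      (ae_of_all _ fun x => by positivity)]
    refine lintegral_congr fun x => ?_
    rw [ENNReal.ofReal_pow (norm_nonneg _), ofReal_norm]
  rw [key, key, SchwartzMap.integral_norm_sq_fourier]

theorem rpow_le_one_add_pow {t s : ℝ} {m : ℕ} (ht : 0 ≤ t) (hs : 0 < s) (hsm : s ≤ m) :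
    t ^ (2 * s) ≤ 1 + (t ^ 2) ^ m := by
  have h2 : (t ^ 2) ^ m = t ^ (2 * (m : ℝ)) := by
    rw [← pow_mul, ← Real.rpow_natCast]; push_cast; rfl
  rw [h2]
  rcases le_total t 1 with h | h
  · have := Real.rpow_le_one ht h (by positivity : 0 ≤ 2 * s)
    have := Real.rpow_nonneg ht (2 * (m : ℝ))
    linarith
  · have := Real.rpow_le_rpow_of_exponent_le h (by linarith : 2 * s ≤ 2 * (m : ℝ))
    linarith

/-- Parseval and the power mean inequality. This lets pure derivatives along an orthonormal basis
control the full symbol, with no mixed derivatives. -/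
theorem norm_sq_pow_le_sum_inner_pow {V : Type*} [NormedAddCommGroup V]
    [InnerProductSpace ℝ V] {ι : Type*} [Fintype ι] (b : OrthonormalBasis ι ℝ V) (n : ℕ) (ξ : V) :
    (‖ξ‖ ^ 2) ^ (n + 1) ≤ (Fintype.card ι : ℝ) ^ n * ∑ i, (inner ℝ ξ (b i) ^ 2) ^ (n + 1) := by
  have h := b.sum_sq_norm_inner_left ξ
  simp only [Real.norm_eq_abs, sq_abs] at h
  have h1 : (fun i => inner ℝ (b i) ξ ^ 2) = fun i => inner ℝ ξ (b i) ^ 2 := by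
    ext i; rw [real_inner_comm]
  rcases isEmpty_or_nonempty ι with hι | hι
  · simp only [Finset.univ_eq_empty, Finset.sum_empty] at h
    rw [← h]; simp
  · have := pow_sum_div_card_le_sum_pow (s := Finset.univ)
      (f := fun i => inner ℝ ξ (b i) ^ 2) (fun i _ => by positivity) n
    rw [div_le_iff₀ (by simp; positivity)] at this
    rw [← h]
    calc _ ≤ _ := this
      _ = _ := by rw [mul_comm]; simp

theorem sobolev_symbol_mul_le {V : Type*} [NormedAddCommGroup V]
    [InnerProductSpace ℝ V] [FiniteDimensional ℝ V] [MeasurableSpace V] [BorelSpace V]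
    {ι : Type*} [Fintype ι] (b : OrthonormalBasis ι ℝ V) {s : ℝ} {n : ℕ} (hs : 0 < s)
    (hsn : s ≤ (n + 1 : ℕ)) (f : SchwartzMap V ℂ) (ξ : V) :
    ENNReal.ofReal (1 + (2 * Real.pi * ‖ξ‖) ^ (2 * s)) * ‖𝓕 f ξ‖ₑ ^ 2 ≤
      ENNReal.ofReal (2 + (Fintype.card ι : ℝ) ^ n) * (‖𝓕 f ξ‖ₑ ^ 2 +
        ∑ i, ‖𝓕 (LineDeriv.iteratedLineDerivOp (fun _ : Fin (n + 1) => b i) f) ξ‖ₑ ^ 2) := by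
  have e1 (z : ℂ) : ‖z‖ₑ ^ 2 = ENNReal.ofReal (‖z‖ ^ 2) := by
    rw [ENNReal.ofReal_pow (norm_nonneg _), ofReal_norm]
  simp only [e1]
  rw [← ENNReal.ofReal_sum_of_nonneg (fun i _ => by positivity),
    ← ENNReal.ofReal_add (by positivity) (Finset.sum_nonneg fun i _ => by positivity),
    ← ENNReal.ofReal_mul (by positivity), ← ENNReal.ofReal_mul (by positivity)]
  apply ENNReal.ofReal_le_ofReal
  have h1 := rpow_le_one_add_pow (t := 2 * Real.pi * ‖ξ‖) (by positivity) hs hsn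
  have h2 := norm_sq_pow_le_sum_inner_pow b n ξ
  have h3 (i : ι) :
      ‖𝓕 (LineDeriv.iteratedLineDerivOp (fun _ : Fin (n + 1) => b i) f) ξ‖ ^ 2 =
      ((2 * Real.pi) ^ 2) ^ (n + 1) * (inner ℝ ξ (b i) ^ 2) ^ (n + 1) * ‖𝓕 f ξ‖ ^ 2 := by
    rw [fourier_iteratedLineDerivOp_const]
    simp only [norm_mul, norm_pow, Complex.norm_I, Complex.norm_real, Real.norm_eq_abs,
      Complex.norm_ofNat, mul_one]
    rw [← sq_abs (inner ℝ ξ (b i)), abs_of_pos Real.pi_pos]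
    generalize 2 * Real.pi = t
    ring
  simp only [h3]
  rw [← Finset.sum_mul, ← Finset.mul_sum, ← one_add_mul, ← mul_assoc]
  refine mul_le_mul_of_nonneg_right ?_ (by positivity)
  rw [mul_pow (2 * Real.pi) ‖ξ‖, mul_pow _ (‖ξ‖ ^ 2)] at h1
  have h6 : 0 ≤ ∑ i, (inner ℝ ξ (b i) ^ 2) ^ (n + 1) :=
    Finset.sum_nonneg fun i _ => by positivity
  have h4 : 0 ≤ ((2 * Real.pi) ^ 2) ^ (n + 1) := by positivity
  have h8 : (0 : ℝ) ≤ (Fintype.card ι : ℝ) ^ n := by positivity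
  generalize ((2 * Real.pi) ^ 2) ^ (n + 1) = T at *
  generalize (Fintype.card ι : ℝ) ^ n = A at *
  generalize ∑ i, (inner ℝ ξ (b i) ^ 2) ^ (n + 1) = S at *
  have h5 := mul_le_mul_of_nonneg_left h2 h4
  have h9 : 0 ≤ T * S := mul_nonneg h4 h6
  calc _ ≤ 1 + (1 + T * (A * S)) := by linarith
    _ ≤ (2 + A) * (1 + T * S) := by linarith

theorem enorm_iteratedLineDerivOp_le {V : Type*} [NormedAddCommGroup V]
    [NormedSpace ℝ V] (f : SchwartzMap V ℂ) {v : V} (hv : ‖v‖ = 1) (m : ℕ) (x : V) :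
    ‖LineDeriv.iteratedLineDerivOp (fun _ : Fin m => v) f x‖ₑ ≤ ‖iteratedFDeriv ℝ m f x‖ₑ := by
  rw [SchwartzMap.iteratedLineDerivOp_eq_iteratedFDeriv, ← ofReal_norm, ← ofReal_norm]
  apply ENNReal.ofReal_le_ofReal
  refine (ContinuousMultilinearMap.le_opNorm _ _).trans ?_
  simp [hv]

/-- The symbol of order `s ≤ m` is dominated pointwise by 1 and the squared symbols of the `∂_i^m`;
Plancherel turns this into `L²` norms. Later estimates therefore only need sup bounds on derivatives
and volumes of supports. -/
theorem exists_lintegral_sobolev_symbol_le (V : Type*) [NormedAddCommGroup V]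
    [InnerProductSpace ℝ V] [FiniteDimensional ℝ V] [MeasurableSpace V] [BorelSpace V]
    {s : ℝ} {m : ℕ} (hs : 0 < s) (hsm : s ≤ m) :
    ∃ C : ℝ≥0∞, C ≠ ⊤ ∧ ∀ f : SchwartzMap V ℂ,
      ∫⁻ ξ, ENNReal.ofReal (1 + (2 * Real.pi * ‖ξ‖) ^ (2 * s)) * ‖𝓕 f ξ‖ₑ ^ 2 ≤
        C * ((∫⁻ x, ‖f x‖ₑ ^ 2) + ∫⁻ x, ‖iteratedFDeriv ℝ m f x‖ₑ ^ 2) := by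
  obtain ⟨n, rfl⟩ : ∃ n, m = n + 1 := by
    refine ⟨m - 1, ?_⟩
    have : 0 < (m : ℝ) := hs.trans_le hsm
    have : 0 < m := by exact_mod_cast this
    omega
  obtain ⟨D, ⟨b⟩⟩ : ∃ D : ℕ, Nonempty (OrthonormalBasis (Fin D) ℝ (V)) :=
    ⟨_, ⟨stdOrthonormalBasis ℝ (V)⟩⟩
  have hpt := sobolev_symbol_mul_le b hs hsm
  generalize hKdef : ENNReal.ofReal (2 + (Fintype.card (Fin D) : ℝ) ^ n) = K at hpt
  have hK : K ≠ ⊤ := by rw [← hKdef]; finiteness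
  refine ⟨K * (1 + D), by finiteness, fun f => ?_⟩
  have hmeas (h : SchwartzMap (V) ℂ) : Measurable fun x => ‖h x‖ₑ ^ 2 :=
    (h.continuous.enorm.measurable).pow_const 2
  calc _ ≤ _ := lintegral_mono (hpt f)
    _ = K * ((∫⁻ x, ‖f x‖ₑ ^ 2) +
          ∑ i, ∫⁻ x, ‖LineDeriv.iteratedLineDerivOp (fun _ : Fin (n + 1) => b i) f x‖ₑ ^ 2) := by
        rw [lintegral_const_mul' _ _ hK, lintegral_add_left (hmeas _),
          lintegral_finsetSum _ fun i _ => hmeas _]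
        simp only [lintegral_enorm_sq_fourier]
    _ ≤ K * ((∫⁻ x, ‖f x‖ₑ ^ 2) + D * ∫⁻ x, ‖iteratedFDeriv ℝ (n + 1) f x‖ₑ ^ 2) := by
        gcongr
        calc _ ≤ ∑ i : Fin D, ∫⁻ x, ‖iteratedFDeriv ℝ (n + 1) f x‖ₑ ^ 2 :=
              Finset.sum_le_sum fun i _ => lintegral_mono fun x => by
                gcongr; exact enorm_iteratedLineDerivOp_le f (b.orthonormal.1 i) _ x
          _ = _ := by simp
    _ ≤ _ := by
        rw [mul_assoc, mul_add (1 + (D : ℝ≥0∞))]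
        gcongr
        · calc _ = 1 * ∫⁻ x, ‖f x‖ₑ ^ 2 := (one_mul _).symm
            _ ≤ _ := by gcongr; exact le_self_add
        · exact le_add_self

theorem exists_sobolevNormSq_toLp_le (d N : ℕ) {s : ℝ} {m : ℕ} (hs : 0 < s) (hsm : s ≤ m) :
    ∃ C : ℝ≥0∞, C ≠ ⊤ ∧ ∀ f : SchwartzMap (Config d N) ℂ,
      sobolevNormSq s (f.toLp 2) ≤
        C * ((∫⁻ x, ‖f x‖ₑ ^ 2) + ∫⁻ x, ‖iteratedFDeriv ℝ m f x‖ₑ ^ 2) := by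
  obtain ⟨C, hC, h⟩ := exists_lintegral_sobolev_symbol_le (Config d N) hs hsm
  refine ⟨C, hC, fun f => le_trans (le_of_eq ?_) (h f)⟩
  rw [sobolevNormSq, SchwartzMap.toLp_fourier_eq]
  refine lintegral_congr_ae ?_
  filter_upwards [(𝓕 f).coeFn_toLp 2 (volume : Measure (Config d N))] with ξ hξ
  rw [hξ]

theorem schwartz_toLp_eq {d N : ℕ} {φ : Config d N → ℂ} (hs : ContDiff ℝ ∞ φ)
    (hc : HasCompactSupport φ) (hφ : MemLp φ 2 (volume : Measure (Config d N))) :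
    (hc.toSchwartzMap hs).toLp 2 = hφ.toLp φ := by
  refine Lp.ext ?_
  filter_upwards [hφ.coeFn_toLp, (hc.toSchwartzMap hs).coeFn_toLp 2 volume] with x h1 h2
  rw [h1, h2]
  rfl

theorem exists_sobolevNormSq_le (d N : ℕ) {s : ℝ} {m : ℕ} (hs : 0 < s) (hsm : s ≤ m) :
    ∃ C : ℝ≥0∞, C ≠ ⊤ ∧ ∀ φ : Config d N → ℂ, ContDiff ℝ ∞ φ → HasCompactSupport φ →
      ∀ hφ : MemLp φ 2 (volume : Measure (Config d N)), sobolevNormSq s (hφ.toLp φ) ≤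
        C * ((∫⁻ x, ‖φ x‖ₑ ^ 2) + ∫⁻ x, ‖iteratedFDeriv ℝ m φ x‖ₑ ^ 2) := by
  obtain ⟨C, hC, h⟩ := exists_sobolevNormSq_toLp_le d N hs hsm
  refine ⟨C, hC, fun φ hs hc hφ => ?_⟩
  rw [← schwartz_toLp_eq hs hc]
  exact h _

theorem lintegral_enorm_sq_lt_top {E F : Type*} [TopologicalSpace E] [R1Space E]
    [MeasurableSpace E] [BorelSpace E] [NormedAddCommGroup F] (μ : Measure E)
    [IsFiniteMeasureOnCompacts μ] {f : E → F} (hf : Continuous f) (hc : HasCompactSupport f) :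
    ∫⁻ x, ‖f x‖ₑ ^ 2 ∂μ < ⊤ := by
  have h : Integrable (fun x => ‖f x‖ ^ 2) μ :=
    (hf.memLp_of_hasCompactSupport (p := 2) hc).norm.integrable_sq
  refine lt_of_le_of_lt (le_of_eq ?_) h.2
  refine lintegral_congr fun x => ?_
  simp [enorm_pow]

theorem lintegral_enorm_iteratedFDeriv_sq_lt_top {V : Type*} [NormedAddCommGroup V]
    [InnerProductSpace ℝ V] [FiniteDimensional ℝ V] [MeasurableSpace V] [BorelSpace V]
    {f : V → ℂ} (h : ContDiff ℝ ∞ f) (hc : HasCompactSupport f) (m : ℕ) :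
    ∫⁻ x, ‖iteratedFDeriv ℝ m f x‖ₑ ^ 2 < ⊤ :=
  lintegral_enorm_sq_lt_top _ (h.continuous_iteratedFDeriv (by exact_mod_cast le_top))
    (hc.iteratedFDeriv _)

theorem toLp_mem_sobolevSpace {d N : ℕ} {s : ℝ} (hs : 0 < s) {φ : Config d N → ℂ}
    (h : ContDiff ℝ ∞ φ) (hc : HasCompactSupport φ)
    (hφ : MemLp φ 2 (volume : Measure (Config d N))) : hφ.toLp φ ∈ sobolevSpace d N s := by
  obtain ⟨C, hC, hle⟩ := exists_sobolevNormSq_le d N hs (Nat.le_ceil s)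
  refine (hle φ h hc hφ).trans_lt (ENNReal.mul_lt_top hC.lt_top (ENNReal.add_lt_top.2 ⟨?_, ?_⟩))
  · exact lintegral_enorm_sq_lt_top _ h.continuous hc
  · exact lintegral_enorm_iteratedFDeriv_sq_lt_top h hc _

/-! ### Cutoffs, the norm on `Ω^N`, and failure of the inequality. -/

theorem isOpen_box {d N : ℕ} {Ω : Set (Pt d)} (hΩ : IsOpen Ω) : IsOpen (box N Ω) := by
  have : box N Ω = ⋂ j, (fun x : Config d N => x j) ⁻¹' Ω := by ext; simp [box]
  rw [this]
  exact isOpen_iInter_of_finite fun j => hΩ.preimage (by fun_prop)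

/-- Nonzero polynomials on the whole space need not be square integrable. Multiplying by `χ` changes
nothing on `Ω^N` and makes them compactly supported. -/
theorem exists_cutoff (d N : ℕ) {Ω : Set (Pt d)} (hΩ : Bornology.IsBounded Ω) :
    ∃ χ : Config d N → ℂ, ContDiff ℝ ∞ χ ∧ HasCompactSupport χ ∧ (∀ x ∈ box N Ω, χ x = 1) ∧
      ∀ x, ‖χ x‖ ≤ 1 := by
  obtain ⟨R, hR⟩ := hΩ.exists_norm_le
  obtain ⟨r, hr0, hr⟩ : ∃ r : ℝ, 0 < r ∧ ∀ x ∈ box N Ω, ‖x‖ ≤ r := by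
    refine ⟨√(∑ _j : Fin N, R ^ 2) + 1, by positivity, fun x hx => ?_⟩
    rw [PiLp.norm_eq_of_L2]
    refine le_trans (Real.sqrt_le_sqrt ?_) (le_add_of_nonneg_right zero_le_one)
    exact Finset.sum_le_sum fun j _ => pow_le_pow_left₀ (norm_nonneg _) (hR _ (hx j)) 2
  let b : ContDiffBump (0 : Config d N) := ⟨r, r + 1, hr0, by linarith⟩
  refine ⟨fun x => (b x : ℂ), ?_, ?_, fun x hx => ?_, fun x => ?_⟩
  · exact Complex.ofRealCLM.contDiff.comp b.contDiff
  · exact b.hasCompactSupport.comp_left (g := fun t : ℝ => (t : ℂ)) (by simp)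
  · simp [b.one_of_mem_closedBall (by simpa [b] using hr x hx)]
  · rw [Complex.norm_real, Real.norm_eq_abs, abs_of_nonneg b.nonneg]
    exact b.le_one

theorem memLp_of_smooth_compactSupport {d N : ℕ} {φ : Config d N → ℂ} (h : ContDiff ℝ ∞ φ)
    (hc : HasCompactSupport φ) : MemLp φ 2 (volume : Measure (Config d N)) :=
  h.continuous.memLp_of_hasCompactSupport hc

theorem boxNorm_ne_top {d N : ℕ} {Ω : Set (Pt d)} (hΩ : Bornology.IsBounded Ω)
    (hΩ' : IsOpen Ω) {u : Config d N → ℂ} (hu : ContDiff ℝ ∞ u) : boxNorm Ω u ≠ ⊤ := by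
  obtain ⟨χ, hχ, hχc, hχ1, -⟩ := exists_cutoff d N hΩ
  have h := (memLp_of_smooth_compactSupport (hχ.mul hu) hχc.mul_right).restrict (box N Ω)
  refine ne_of_eq_of_ne ?_ h.2.ne
  refine eLpNorm_congr_ae ?_
  filter_upwards [ae_restrict_mem (isOpen_box hΩ').measurableSet] with x hx
  simp [hχ1 x hx]

theorem boxNorm_ne_zero {d N : ℕ} {Ω : Set (Pt d)} (hΩ : IsOpen Ω) {u : Config d N → ℂ}
    (hu : Continuous u) {x : Config d N} (hx : x ∈ box N Ω) (hux : u x ≠ 0) :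
    boxNorm Ω u ≠ 0 := by
  intro h
  rw [boxNorm, eLpNorm_eq_zero_iff hu.aestronglyMeasurable (by norm_num)] at h
  exact hux (Measure.eqOn_open_of_ae_eq h (isOpen_box hΩ) hu.continuousOn continuousOn_const hx)

theorem IsCounterexample.not_poincareInequality {d N k : ℕ} {s : ℝ} {Ω : Set (Pt d)}
    {u : Config d N → ℂ} (h : IsCounterexample k s Ω u) :
    ¬ PoincareInequality s Ω (vanishingClass N k Ω) ∧
    ¬ PoincareInequality s Ω (restrictionClass Ω (hardCoreSpace d N k s)) ∧
    ¬ PoincareInequality s Ω (restrictionClass Ω (potentialSpace d N k s)) := by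
  obtain ⟨h1, ⟨h2, Ψ, hΨ, hΨu⟩, h3, -, h5⟩ := h
  have key (𝒞 : Set (Config d N → ℂ)) (hu : u ∈ 𝒞) : ¬ PoincareInequality s Ω 𝒞 := by
    rintro ⟨C, hC, hle⟩
    have := hle u hu
    rw [h5, nonpos_iff_eq_zero, mul_eq_zero, ENNReal.ofReal_eq_zero] at this
    rcases this with h | h
    · exact absurd h hC.not_ge
    · exact h3 h
  exact ⟨key _ h1, key _ ⟨h2, Ψ, hΨ.1, hΨu⟩, key _ ⟨h2, Ψ, hΨ.2, hΨu⟩⟩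

/-! ### One-particle seminorms of polynomials in the first coordinate. -/

section eval

open Polynomial

theorem partialDeriv_eval {d : ℕ} [NeZero d] (i : Fin d) (q : ℂ[X]) :
    partialDeriv i (fun y : Pt d => q.eval ((y 0 : ℝ) : ℂ)) =
      fun y => (if i = 0 then derivative q else 0).eval ((y 0 : ℝ) : ℂ) := by
  ext y
  refine HasLineDerivAt.lineDeriv ?_
  rw [HasLineDerivAt]
  by_cases hi : i = 0
  · subst hi
    simp only [if_true, PiLp.add_apply, PiLp.smul_apply, PiLp.single_apply, smul_eq_mul,
      mul_one]
    have h := (q.hasDerivAt (((y 0 + 0 : ℝ)) : ℂ)).comp_ofReal (z := y 0 + 0)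
    have h2 : HasDerivAt (fun t : ℝ => y 0 + t) 1 0 := (hasDerivAt_id 0).const_add _
    simpa [Function.comp_def] using HasDerivAt.scomp (0 : ℝ) h h2
  · simp [hi, Ne.symm hi, hasDerivAt_const]

theorem derivative_mem_degreeLT {q : ℂ[X]} {n : ℕ} (h : q ∈ degreeLT ℂ n) :
    derivative q ∈ degreeLT ℂ (n - 1) := by
  rw [mem_degreeLT, degree_lt_iff_coeff_zero] at h ⊢
  intro j hj
  rw [coeff_derivative, h (j + 1) (by omega), zero_mul]

theorem iterate_partialDeriv_eval {d : ℕ} [NeZero d] (i : Fin d) (a : ℕ) {q : ℂ[X]} {n : ℕ}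
    (h : q ∈ degreeLT ℂ n) : ∃ r ∈ degreeLT ℂ (n - a),
      (partialDeriv i)^[a] (fun y : Pt d => q.eval ((y 0 : ℝ) : ℂ)) =
        fun y => r.eval ((y 0 : ℝ) : ℂ) := by
  induction a with
  | zero => exact ⟨q, by simpa using h, rfl⟩
  | succ a ih =>
    obtain ⟨r, hr, he⟩ := ih
    rw [Function.iterate_succ_apply', he, partialDeriv_eval]
    refine ⟨_, ?_, rfl⟩
    split_ifs
    · exact derivative_mem_degreeLT hr
    · exact zero_mem _

/-- Polynomials in the first coordinate are stable under every partial derivative. Along that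
coordinate the degree bound drops by one; in the other directions the result is 0, which satisfies
every bound. The truncated subtraction is harmless, as `degreeLT ℂ 0` is trivial. -/
theorem multiDeriv_eval {d : ℕ} [NeZero d] (α : Fin d → ℕ) {q : ℂ[X]} {n : ℕ}
    (h : q ∈ degreeLT ℂ n) : ∃ r ∈ degreeLT ℂ (n - ∑ i, α i),
      multiDeriv α (fun y : Pt d => q.eval ((y 0 : ℝ) : ℂ)) =
        fun y => r.eval ((y 0 : ℝ) : ℂ) := by
  have key (l : List (Fin d)) : ∃ r ∈ degreeLT ℂ (n - (l.map α).sum),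
      l.foldr (fun i g => (partialDeriv i)^[α i] g) (fun y : Pt d => q.eval ((y 0 : ℝ) : ℂ)) =
        fun y => r.eval ((y 0 : ℝ) : ℂ) := by
    induction l with
    | nil => exact ⟨q, by simpa using h, rfl⟩
    | cons i l ih =>
      obtain ⟨r, hr, he⟩ := ih
      obtain ⟨r', hr', he'⟩ := iterate_partialDeriv_eval i (α i) hr
      refine ⟨r', ?_, ?_⟩
      · rw [List.map_cons, List.sum_cons, add_comm, ← Nat.sub_sub]
        exact hr'
      · rw [List.foldr_cons, he, he']
  obtain ⟨r, hr, he⟩ := key (List.finRange d)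
  refine ⟨r, ?_, he⟩
  rwa [← List.ofFn_eq_map, List.sum_ofFn] at hr

theorem eval_eq_zero_of_degreeLT_zero {q : ℂ[X]} (h : q ∈ degreeLT ℂ 0) (z : ℂ) :
    q.eval z = 0 := by
  rw [mem_degreeLT, degree_lt_iff_coeff_zero] at h
  have : q = 0 := by ext j; simpa using h j (Nat.zero_le _)
  simp [this]

theorem eval_eq_of_degreeLT_one {q : ℂ[X]} (h : q ∈ degreeLT ℂ 1) (z w : ℂ) :
    q.eval z = q.eval w := by
  rw [mem_degreeLT, degree_lt_iff_coeff_zero] at h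
  have : q = C (q.coeff 0) := eq_C_of_degree_le_zero (by
    rw [degree_le_iff_coeff_zero]
    intro j hj
    exact h j (Nat.succ_le_of_lt (by simpa using hj)))
  rw [this]; simp

theorem seminormSq_eval_eq_zero {d : ℕ} [NeZero d] (m : ℕ) (Ω : Set (Pt d)) {q : ℂ[X]}
    (h : q ∈ degreeLT ℂ m) :
    seminormSq (m : ℝ) Ω (fun y : Pt d => q.eval ((y 0 : ℝ) : ℂ)) = 0 := by
  rw [seminormSq, if_pos (by simp)]
  refine Finset.sum_eq_zero fun α hα => ?_
  rw [multiIndices, Nat.floor_natCast, Finset.mem_piAntidiag] at hα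
  obtain ⟨r, hr, he⟩ := multiDeriv_eval α h
  rw [hα.1, Nat.sub_self] at hr
  simp [he, eval_eq_zero_of_degreeLT_zero hr]

theorem seminormSq_const {d : ℕ} [NeZero d] {s : ℝ} (hs : 0 < s) (Ω : Set (Pt d)) (c : ℂ) :
    seminormSq s Ω (fun _ : Pt d => c) = 0 := by
  have hc : C c ∈ degreeLT ℂ 1 := by
    rw [mem_degreeLT]
    exact degree_C_le.trans_lt (by norm_num)
  rcases eq_or_ne (Int.fract s) 0 with h | h
  · obtain ⟨n, hn⟩ : ∃ n : ℕ, s = n := by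
      obtain ⟨z, hz⟩ := Int.fract_eq_zero_iff.1 h
      have : 0 ≤ z := by
        have : (0 : ℝ) ≤ z := by rw [hz]; exact hs.le
        exact_mod_cast this
      exact ⟨z.toNat, by rw [← hz]; exact_mod_cast (Int.toNat_of_nonneg this).symm⟩
    -- Positivity of `s` enters here: at order 0 the seminorm would be the `L²` norm.
    have hn1 : 1 ≤ n := by
      rw [hn] at hs
      exact_mod_cast hs
    have := seminormSq_eval_eq_zero n Ω (degreeLT_mono hn1 hc)
    rw [hn]
    simpa using this
  · rw [seminormSq, if_neg h]
    refine mul_eq_zero_of_right _ (Finset.sum_eq_zero fun α _ => ?_)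
    obtain ⟨r, hr, he⟩ := multiDeriv_eval α hc
    simp only [eval_C] at he
    -- For `s < 1` the multi-index may be 0, so the derivative need not vanish; it is still
    -- constant, and its differences vanish.
    have hr1 := degreeLT_mono (Nat.sub_le _ _) hr
    have hz (x y : Pt d) : r.eval ((x 0 : ℝ) : ℂ) - r.eval ((y 0 : ℝ) : ℂ) = 0 :=
      sub_eq_zero.2 (eval_eq_of_degreeLT_one hr1 _ _)
    simp [he, hz]

end eval

/-! ### The case of fewer than `k` particles. -/

theorem manySeminorm_eq_zero {d N : ℕ} {s : ℝ} {Ω : Set (Pt d)} {u : Config d N → ℂ}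
    (h : ∀ j x', seminormSq s Ω (fun y => u (insertAt j y x')) = 0) : manySeminorm s Ω u = 0 := by
  simp [manySeminorm, h]

theorem isCounterexample_one {d N k : ℕ} [NeZero d] {Ω : Set (Pt d)} (hΩ_open : IsOpen Ω)
    (hΩ_nonempty : Ω.Nonempty) (hΩ_bounded : Bornology.IsBounded Ω) (hNk : N < k) {s : ℝ}
    (hs : 0 < s) : IsCounterexample k s Ω (fun _ : Config d N => (1 : ℂ)) := by
  have hcard (A : Finset (Fin N)) : A.card ≠ k := by
    have := A.card_le_univ
    rw [Fintype.card_fin] at this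
    omega
  have hdiag : diagonal d N k = ∅ := by
    refine Set.eq_empty_of_forall_notMem fun x ⟨A, hA, _⟩ => hcard A hA
  obtain ⟨χ, hχ, hχc, hχ1, -⟩ := exists_cutoff d N hΩ_bounded
  have hmem := memLp_of_smooth_compactSupport hχ hχc
  have hsob := toLp_mem_sobolevSpace hs hχ hχc hmem
  obtain ⟨p₀, hp₀⟩ := hΩ_nonempty
  refine ⟨⟨contDiffOn_const, by simp [hdiag]⟩,
    ⟨contDiffOn_const, hmem.toLp χ, ⟨⟨hsob, fun ε hε => ?_⟩, hsob, ?_⟩, ?_⟩,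
    boxNorm_ne_zero hΩ_open continuous_const (x := WithLp.toLp 2 fun _ => p₀)
      (fun _ => hp₀) one_ne_zero,
    boxNorm_ne_top hΩ_bounded hΩ_open contDiff_const,
    manySeminorm_eq_zero fun j x' => seminormSq_const hs Ω 1⟩
  · refine ⟨χ, hχ, hχc, by simp [hdiag], hmem, ?_⟩
    have h0 : sobolevNormSq s (0 : L2 d N) = 0 := by simp [sobolevNormSq]
    rwa [sub_self, h0]
  · have hp (x : Config d N) : potential k s x = 0 := by
      rw [potential, Finset.powersetCard_eq_empty.2 (by simpa using hNk), Finset.sum_empty]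
    simp [hp]
  · filter_upwards [ae_restrict_of_ae hmem.coeFn_toLp,
      ae_restrict_mem (isOpen_box hΩ_open).measurableSet] with x hx hxb
    rw [hx, hχ1 x hxb]

/-! ### Volume of neighbourhoods of the total diagonal. -/

/-- The configurations whose first particle is within distance `R` of the origin and whose other
particles are within distance `δ` of the first one. -/
def tube (d K : ℕ) (R δ : ℝ) : Set (Config d (K + 1)) :=
  {x | ‖x 0‖ ≤ R ∧ ∀ j, ‖x j - x 0‖ ≤ δ}

theorem measurableSet_tube (d K : ℕ) (R δ : ℝ) : MeasurableSet (tube d K R δ) := by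
  have : tube d K R δ = {x : Config d (K + 1) | ‖x 0‖ ≤ R} ∩ ⋂ j, {x | ‖x j - x 0‖ ≤ δ} := by
    ext; simp [tube]
  rw [this]
  exact ((isClosed_le (by fun_prop) (by fun_prop)).inter
    (isClosed_iInter fun j => isClosed_le (by fun_prop) (by fun_prop))).measurableSet

/-- Fubini over the first particle: once it is placed at `a`, the other `K` particles range over a
product of balls of radius `δ` around `a`. -/
theorem volume_pi_tube_le {E : Type*} [NormedAddCommGroup E] [InnerProductSpace ℝ E]
    [FiniteDimensional ℝ E] [MeasurableSpace E] [BorelSpace E] (K : ℕ) (R : ℝ) {δ : ℝ}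
    (hδ : 0 ≤ δ) :
    volume {x : Fin (K + 1) → E | ‖x 0‖ ≤ R ∧ ∀ j, ‖x j - x 0‖ ≤ δ} ≤
      volume (Metric.ball (0 : E) 1) ^ K * volume (Metric.closedBall (0 : E) R) *
        ENNReal.ofReal (δ ^ (Module.finrank ℝ E * K)) := by
  have mp := volume_preserving_piFinSuccAbove (fun _ : Fin (K + 1) => E) 0
  let S : Set (E × (Fin K → E)) := {z | ‖z.1‖ ≤ R ∧ ∀ j, ‖z.2 j - z.1‖ ≤ δ}
  have hS : MeasurableSet S := by
    have : S = {z | ‖z.1‖ ≤ R} ∩ ⋂ j, {z : E × (Fin K → E) | ‖z.2 j - z.1‖ ≤ δ} := by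
      ext; simp [S]
    rw [this]
    exact ((isClosed_le (by fun_prop) (by fun_prop)).inter
      (isClosed_iInter fun j => isClosed_le (by fun_prop) (by fun_prop))).measurableSet
  have hpre : {x : Fin (K + 1) → E | ‖x 0‖ ≤ R ∧ ∀ j, ‖x j - x 0‖ ≤ δ} ⊆
      MeasurableEquiv.piFinSuccAbove (fun _ : Fin (K + 1) => E) 0 ⁻¹' S := by
    rintro x ⟨h1, h2⟩
    exact ⟨h1, fun j => h2 j.succ⟩
  refine (measure_mono hpre).trans ?_
  rw [mp.measure_preimage hS.nullMeasurableSet, Measure.volume_eq_prod, Measure.prod_apply hS]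
  have hpt (a : E) : volume (Prod.mk a ⁻¹' S) ≤
      (Metric.closedBall (0 : E) R).indicator
        (fun _ => (ENNReal.ofReal (δ ^ Module.finrank ℝ E) *
          volume (Metric.ball (0 : E) 1)) ^ K) a := by
    by_cases ha : a ∈ Metric.closedBall (0 : E) R
    · rw [Set.indicator_of_mem ha]
      have : Prod.mk a ⁻¹' S ⊆ Set.univ.pi fun _ : Fin K => Metric.closedBall a δ := by
        rintro y ⟨-, h⟩ j -
        simpa [dist_eq_norm] using h j
      refine (measure_mono this).trans ?_
      rw [volume_pi_pi]
      simp [Measure.addHaar_closedBall _ _ hδ]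
    · rw [Set.indicator_of_notMem ha]
      refine le_of_eq ?_
      have : Prod.mk a ⁻¹' S = ∅ := by
        refine Set.eq_empty_of_forall_notMem fun y hy => ha ?_
        simpa using hy.1
      rw [this, measure_empty]
  refine (lintegral_mono hpt).trans (le_of_eq ?_)
  rw [lintegral_indicator Metric.isClosed_closedBall.measurableSet, setLIntegral_const, mul_pow,
    ← ENNReal.ofReal_pow (by positivity), ← pow_mul]
  ring

theorem exists_volume_tube_le (d K : ℕ) (R : ℝ) : ∃ C : ℝ≥0∞, C ≠ ⊤ ∧ ∀ δ : ℝ, 0 ≤ δ →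
    volume (tube d K R δ) ≤ C * ENNReal.ofReal (δ ^ (d * K)) := by
  let e := PiLp.continuousLinearEquiv 2 ℝ (fun _ : Fin (K + 1) => Pt d)
  let μ : Measure (Fin (K + 1) → Pt d) := (volume : Measure (Config d (K + 1))).map e
  have : μ.IsAddHaarMeasure := e.isAddHaarMeasure_map _
  -- Uniqueness of Haar measure transfers the product bound to the Euclidean configuration space;
  -- the value of `c` is irrelevant.
  obtain ⟨c, hμ⟩ : ∃ c : NNReal, μ = c • volume :=
    ⟨_, Measure.isAddLeftInvariant_eq_smul μ volume⟩
  refine ⟨c * (volume (Metric.ball (0 : Pt d) 1) ^ K *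
    volume (Metric.closedBall (0 : Pt d) R)), ?_, fun δ hδ => ?_⟩
  · have h1 := (measure_ball_lt_top (μ := (volume : Measure (Pt d))) (x := 0) (r := 1)).ne
    have h2 := (measure_closedBall_lt_top (μ := (volume : Measure (Pt d))) (x := 0) (r := R)).ne
    finiteness
  · have h1 := volume_pi_tube_le (E := Pt d) K R hδ
    have h2 : volume (tube d K R δ) =
        μ {x : Fin (K + 1) → Pt d | ‖x 0‖ ≤ R ∧ ∀ j, ‖x j - x 0‖ ≤ δ} :=
      (e.toHomeomorph.toMeasurableEquiv.map_apply
        {x : Fin (K + 1) → Pt d | ‖x 0‖ ≤ R ∧ ∀ j, ‖x j - x 0‖ ≤ δ}).symm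
    rw [h2, hμ, Measure.smul_apply, mul_assoc]
    simp only [finrank_euclideanSpace, Fintype.card_fin] at h1
    exact mul_le_mul_right h1 _

/-! ### The difference product: degree, zeros, homogeneity. -/

open Polynomial in
theorem exists_eval_differenceProduct_insertAt {d N : ℕ} [NeZero d] (j : Fin N)
    (x' : {i : Fin N // i ≠ j} → Pt d) : ∃ q ∈ degreeLT ℂ N,
      (fun y => differenceProduct (insertAt j y x')) = fun y : Pt d => q.eval ((y 0 : ℝ) : ℂ) := by
  let P : Fin N → ℂ[X] := fun i => if h : i = j then X else C (((x' ⟨i, h⟩ 0 : ℝ)) : ℂ)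
  have hP (i : Fin N) : (P i).natDegree ≤ if i = j then 1 else 0 := by
    by_cases h : i = j <;> simp [P, h]
  have hdeg (a b : Fin N) : (P a - P b).natDegree ≤
      (if a = j then 1 else 0) + (if b = j then 1 else 0) :=
    (natDegree_sub_le _ _).trans (max_le ((hP a).trans (Nat.le_add_right _ _))
      ((hP b).trans (Nat.le_add_left _ _)))
  refine ⟨∏ a : Fin N, ∏ b ∈ Finset.Ioi a, (P a - P b), ?_, ?_⟩
  · have h1 : (∏ a : Fin N, ∏ b ∈ Finset.Ioi a, (P a - P b)).natDegree ≤
        ∑ a : Fin N, ∑ b ∈ Finset.Ioi a,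
          ((if a = j then 1 else 0) + (if b = j then 1 else 0)) :=
      (natDegree_prod_le _ _).trans (Finset.sum_le_sum fun a _ =>
        (natDegree_prod_le _ _).trans (Finset.sum_le_sum fun b _ => hdeg a b))
    -- Particle `j` occurs in `N - 1` pairs: `N - 1 - j` times as the smaller index and `j` times as
    -- the larger.
    have h2 : ∑ a : Fin N, ∑ b ∈ Finset.Ioi a,
          ((if a = j then 1 else 0) + (if b = j then 1 else 0)) = N - 1 := by
      have e1 : ∑ a : Fin N, ∑ b ∈ Finset.Ioi a, (if a = j then 1 else 0) = N - 1 - j := by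
        rw [Finset.sum_eq_single j]
        · simp
        · intro b _ hb; simp [hb]
        · simp
      have e2 : ∑ a : Fin N, ∑ b ∈ Finset.Ioi a, (if b = j then 1 else 0) = (j : ℕ) := by
        rw [Finset.sum_comm' (t' := Finset.univ) (s' := fun b => Finset.Iio b) (by simp)]
        rw [Finset.sum_eq_single j]
        · simp
        · intro b _ hb; simp [hb]
        · simp
      simp only [Finset.sum_add_distrib, e1, e2]
      omega
    rw [mem_degreeLT]
    refine degree_le_natDegree.trans_lt ?_
    have := j.isLt
    exact_mod_cast (h1.trans_eq h2).trans_lt (by omega)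
  · ext y
    simp only [eval_prod, eval_sub, differenceProduct]
    refine Finset.prod_congr rfl fun a _ => Finset.prod_congr rfl fun b _ => ?_
    have hPe (i : Fin N) : (P i).eval ((y 0 : ℝ) : ℂ) = ((insertAt j y x' i 0 : ℝ) : ℂ) := by
      by_cases h : i = j <;> simp [P, insertAt, h]
    rw [hPe, hPe, Complex.ofReal_sub]

theorem contDiff_differenceProduct {d N : ℕ} [NeZero d] :
    ContDiff ℝ ∞ (differenceProduct : Config d N → ℂ) := by
  refine contDiff_prod fun j _ => contDiff_prod fun l _ => ?_
  have : ContDiff ℝ ∞ fun x : Config d N => x j 0 - x l 0 := by fun_prop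
  exact Complex.ofRealCLM.contDiff.comp this

theorem differenceProduct_eq_zero {d N : ℕ} [NeZero d] {x : Config d N} {i j : Fin N}
    (hij : i < j) (h : x i = x j) : differenceProduct x = 0 :=
  Finset.prod_eq_zero (Finset.mem_univ i)
    (Finset.prod_eq_zero (Finset.mem_Ioi.2 hij) (by simp [h]))

theorem differenceProduct_ne_zero {d N : ℕ} [NeZero d] {x : Config d N}
    (h : Function.Injective fun i => x i 0) : differenceProduct x ≠ 0 := by
  refine Finset.prod_ne_zero_iff.2 fun i _ => Finset.prod_ne_zero_iff.2 fun j hj => ?_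
  rw [Complex.ofReal_ne_zero, sub_ne_zero]
  exact fun e => (Finset.mem_Ioi.1 hj).ne (h e)

/-- The number of factors of `differenceProduct`. -/
def numPairs (N : ℕ) : ℕ := ∑ j : Fin N, (Finset.Ioi j).card

theorem two_mul_numPairs (K : ℕ) : 2 * numPairs (K + 1) = K * (K + 1) := by
  have : numPairs (K + 1) = ∑ i ∈ Finset.range (K + 1), i := by
    rw [numPairs, ← Finset.sum_range_reflect, ← Fin.sum_univ_eq_sum_range]
    simp
  rw [this, mul_comm, Finset.sum_range_id_mul_two]
  simp [mul_comm]

theorem differenceProduct_smul {d N : ℕ} [NeZero d] (t : ℝ) (x : Config d N) :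
    differenceProduct (t • x) = (t : ℂ) ^ numPairs N * differenceProduct x := by
  simp only [differenceProduct, numPairs, ← Finset.prod_pow_eq_pow_sum, ← Finset.prod_mul_distrib]
  refine Finset.prod_congr rfl fun j _ => ?_
  rw [← Finset.prod_const, ← Finset.prod_mul_distrib]
  refine Finset.prod_congr rfl fun l _ => ?_
  simp only [PiLp.smul_apply, smul_eq_mul, ← mul_sub]
  push_cast
  ring

theorem norm_differenceProduct_le {d N : ℕ} [NeZero d] {x : Config d N} {r : ℝ}
    (h : ∀ j l, ‖x j - x l‖ ≤ r) : ‖differenceProduct x‖ ≤ r ^ numPairs N := by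
  simp only [differenceProduct, numPairs, ← Finset.prod_pow_eq_pow_sum, norm_prod]
  refine Finset.prod_le_prod (fun _ _ => Finset.prod_nonneg fun _ _ => norm_nonneg _) fun j _ => ?_
  rw [← Finset.prod_const]
  refine Finset.prod_le_prod (fun _ _ => norm_nonneg _) fun l _ => ?_
  rw [Complex.norm_real]
  exact (PiLp.norm_apply_le (x j - x l) 0).trans (h j l)

/-- Place the particles at `p₀ + t j e₁` with `t ≠ 0` so small that all of them stay in the open set
`Ω`; their first coordinates are then distinct. -/
theorem exists_box_differenceProduct_ne_zero {d : ℕ} [NeZero d] (N : ℕ) {Ω : Set (Pt d)}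
    (hΩ : IsOpen Ω) (hΩ' : Ω.Nonempty) :
    ∃ x ∈ box N Ω, differenceProduct (x : Config d N) ≠ 0 := by
  obtain ⟨p₀, hp₀⟩ := hΩ'
  have h (j : Fin N) : ∀ᶠ t : ℝ in nhdsWithin 0 {0}ᶜ,
      p₀ + (t * (j : ℝ)) • EuclideanSpace.single (0 : Fin d) (1 : ℝ) ∈ Ω := by
    refine Filter.Eventually.filter_mono nhdsWithin_le_nhds ?_
    have hc : Continuous fun t : ℝ =>
      p₀ + (t * (j : ℝ)) • EuclideanSpace.single (0 : Fin d) (1 : ℝ) := by fun_prop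
    exact hc.continuousAt.eventually (hΩ.mem_nhds (by simpa using hp₀))
  obtain ⟨t, ht, ht0⟩ := ((Filter.eventually_all.2 h).and self_mem_nhdsWithin).exists
  refine ⟨WithLp.toLp 2 fun j : Fin N =>
    p₀ + (t * (j : ℝ)) • EuclideanSpace.single (0 : Fin d) (1 : ℝ), ht, ?_⟩
  refine differenceProduct_ne_zero fun i j hij => ?_
  have ht0 : t ≠ 0 := ht0
  simpa [ht0, Fin.val_inj] using hij

/-! ### Dilations towards the diagonal and their Sobolev norms. -/

/-- The positions of the particles relative to the first one. -/
def relative (d K : ℕ) : Config d (K + 1) →L[ℝ] Config d (K + 1) :=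
  (PiLp.continuousLinearEquiv 2 ℝ (fun _ : Fin (K + 1) => Pt d)).symm.toContinuousLinearMap ∘L
    ContinuousLinearMap.pi fun j =>
      PiLp.proj (𝕜 := ℝ) 2 (fun _ : Fin (K + 1) => Pt d) j - PiLp.proj (𝕜 := ℝ) 2 (fun _ => Pt d) 0

@[simp]
theorem relative_apply {d K : ℕ} (x : Config d (K + 1)) (j : Fin (K + 1)) :
    relative d K x j = x j - x 0 := rfl

theorem differenceProduct_relative {d K : ℕ} [NeZero d] (x : Config d (K + 1)) :
    differenceProduct (relative d K x) = differenceProduct x := by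
  simp [differenceProduct]

theorem exists_norm_iteratedFDeriv_le {E F : Type*} [NormedAddCommGroup E] [NormedSpace ℝ E]
    [NormedAddCommGroup F] [NormedSpace ℝ F] {h : E → F} (hh : ContDiff ℝ ∞ h)
    (hc : HasCompactSupport h) (m : ℕ) :
    ∃ B : ℝ, 0 ≤ B ∧ ∀ j ≤ m, ∀ x, ‖iteratedFDeriv ℝ j h x‖ ≤ B := by
  have key (j : ℕ) : ∃ B : ℝ, ∀ x, ‖iteratedFDeriv ℝ j h x‖ ≤ B :=
    (hc.iteratedFDeriv j).exists_bound_of_continuous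
      (hh.continuous_iteratedFDeriv (by exact_mod_cast le_top))
  choose B hB using key
  refine ⟨∑ j ∈ Finset.range (m + 1), |B j|, Finset.sum_nonneg fun _ _ => abs_nonneg _,
    fun j hj x => (hB j x).trans ((le_abs_self _).trans ?_)⟩
  exact Finset.single_le_sum (f := fun j => |B j|) (fun _ _ => abs_nonneg _)
    (Finset.mem_range.2 (by omega))

theorem exists_norm_iteratedFDeriv_comp_smul_le {E F G : Type*} [NormedAddCommGroup E]
    [NormedSpace ℝ E] [NormedAddCommGroup F] [NormedSpace ℝ F] [NormedAddCommGroup G]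
    [NormedSpace ℝ G] {h : E → F} (hh : ContDiff ℝ ∞ h) (hc : HasCompactSupport h)
    (A : G →L[ℝ] E) (m : ℕ) :
    ∃ B : ℝ, 0 ≤ B ∧ ∀ δ : ℝ, 0 < δ → δ ≤ 1 → ∀ j ≤ m, ∀ x,
      ‖iteratedFDeriv ℝ j (fun y => h (δ⁻¹ • A y)) x‖ ≤ B * (δ⁻¹) ^ m := by
  obtain ⟨B, hB0, hB⟩ := exists_norm_iteratedFDeriv_le hh hc m
  -- With `1 + ‖A‖` in place of `‖A‖`, the base `(1 + ‖A‖) δ⁻¹` is at least 1, so the exponent `j`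
  -- may be raised to `m`.
  refine ⟨B * (1 + ‖A‖) ^ m, by positivity, fun δ hδ hδ1 j hj x => ?_⟩
  have h1 : 1 ≤ δ⁻¹ := (one_le_inv₀ hδ).2 hδ1
  have heq : (fun y => h (δ⁻¹ • A y)) = h ∘ (δ⁻¹ • A) := rfl
  rw [heq, ContinuousLinearMap.iteratedFDeriv_comp_right _ hh x (by exact_mod_cast le_top)]
  refine (ContinuousMultilinearMap.norm_compContinuousLinearMap_le _ _).trans ?_
  rw [Finset.prod_const, Finset.card_univ, Fintype.card_fin, norm_smul, Real.norm_eq_abs,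
    abs_of_pos (inv_pos.2 hδ), mul_assoc, ← mul_pow]
  have h2 : δ⁻¹ * ‖A‖ ≤ (1 + ‖A‖) * δ⁻¹ := by
    have := norm_nonneg A
    nlinarith
  have h3 : 1 ≤ (1 + ‖A‖) * δ⁻¹ := by
    have := norm_nonneg A
    nlinarith
  gcongr
  · exact hB j hj _
  · exact (pow_le_pow_left₀ (by positivity) h2 j).trans (pow_le_pow_right₀ h3 hj)

/-- The dilation of `h ∘ A` by `δ`, normalized as a homogeneous function of degree `p` and
multiplied by `χ`. -/
def dilate {E G : Type*} [NormedAddCommGroup E] [NormedSpace ℝ E] [NormedAddCommGroup G]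
    [NormedSpace ℝ G] (χ : G → ℂ) (h : E → ℂ) (A : G →L[ℝ] E) (p : ℕ) (δ : ℝ) (x : G) : ℂ :=
  χ x * ((δ : ℂ) ^ p * h (δ⁻¹ • A x))

section dilate

variable {E G : Type*} [NormedAddCommGroup E] [NormedSpace ℝ E] [NormedAddCommGroup G]
    [NormedSpace ℝ G] {χ : G → ℂ} {h : E → ℂ}

theorem contDiff_dilate (hχ : ContDiff ℝ ∞ χ) (hh : ContDiff ℝ ∞ h) (A : G →L[ℝ] E) (p : ℕ)
    (δ : ℝ) : ContDiff ℝ ∞ (dilate χ h A p δ) :=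
  hχ.mul (contDiff_const.mul (hh.comp (A.contDiff.const_smul δ⁻¹)))

theorem hasCompactSupport_dilate (hχ : HasCompactSupport χ) (h : E → ℂ) (A : G →L[ℝ] E) (p : ℕ)
    (δ : ℝ) : HasCompactSupport (dilate χ h A p δ) :=
  hχ.mul_right

theorem tsupport_dilate_subset (χ : G → ℂ) (h : E → ℂ) (A : G →L[ℝ] E) (p : ℕ) (δ : ℝ) :
    tsupport (dilate χ h A p δ) ⊆ tsupport χ ∩ {x | δ⁻¹ • A x ∈ tsupport h} := by
  refine closure_minimal (fun x hx => ?_) ?_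
  · rw [Function.mem_support, dilate] at hx
    exact ⟨subset_tsupport _ (left_ne_zero_of_mul hx),
      subset_tsupport _ (right_ne_zero_of_mul (right_ne_zero_of_mul hx))⟩
  · refine (isClosed_tsupport _).inter ((isClosed_tsupport h).preimage ?_)
    exact A.continuous.const_smul _

theorem exists_norm_iteratedFDeriv_dilate_le (hχ : ContDiff ℝ ∞ χ) (hχc : HasCompactSupport χ)
    (hh : ContDiff ℝ ∞ h) (hc : HasCompactSupport h) (A : G →L[ℝ] E) (p m : ℕ) :
    ∃ B : ℝ, 0 ≤ B ∧ ∀ δ : ℝ, 0 < δ → δ ≤ 1 → ∀ j ≤ m, ∀ x,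
      ‖iteratedFDeriv ℝ j (dilate χ h A p δ) x‖ ≤ B * (δ ^ p * (δ⁻¹) ^ m) := by
  obtain ⟨B₁, hB₁, h1⟩ := exists_norm_iteratedFDeriv_le hχ hχc m
  obtain ⟨B₂, hB₂, h2⟩ := exists_norm_iteratedFDeriv_comp_smul_le hh hc A m
  refine ⟨2 ^ m * B₁ * B₂, by positivity, fun δ hδ hδ1 j hj x => ?_⟩
  have hg : ContDiff ℝ ∞ (fun y => h (δ⁻¹ • A y)) := hh.comp (A.contDiff.const_smul δ⁻¹)
  have heq : dilate χ h A p δ = fun y => χ y * ((δ ^ p) • fun y => h (δ⁻¹ • A y)) y := by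
    ext y
    simp [dilate]
  rw [heq]
  refine (norm_iteratedFDeriv_mul_le hχ (hg.const_smul (δ ^ p)) x
    (by exact_mod_cast le_top)).trans ?_
  calc _ ≤ ∑ i ∈ Finset.range (j + 1), (j.choose i : ℝ) * B₁ * (δ ^ p * (B₂ * (δ⁻¹) ^ m)) := by
        refine Finset.sum_le_sum fun i hi => ?_
        have hi' : i ≤ j := Nat.lt_succ_iff.1 (Finset.mem_range.1 hi)
        have e (l : ℕ) (hl : l ≤ m) : ‖iteratedFDeriv ℝ l ((δ ^ p) • fun y => h (δ⁻¹ • A y)) x‖ ≤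
            δ ^ p * (B₂ * (δ⁻¹) ^ m) := by
          rw [iteratedFDeriv_const_smul_apply
            ((hg.of_le (by exact_mod_cast le_top)).contDiffAt), norm_smul, Real.norm_eq_abs,
            abs_of_pos (pow_pos hδ p)]
          gcongr
          exact h2 δ hδ hδ1 _ hl x
        gcongr
        · exact h1 i (by omega) x
        · exact e _ (by omega)
    _ = 2 ^ j * (B₁ * (δ ^ p * (B₂ * (δ⁻¹) ^ m))) := by
        rw [← Finset.sum_mul, ← Finset.sum_mul, ← Nat.cast_sum, Nat.sum_range_choose]
        push_cast
        ring
    _ ≤ 2 ^ m * (B₁ * (δ ^ p * (B₂ * (δ⁻¹) ^ m))) := by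
        gcongr
        norm_num
    _ = _ := by ring

theorem lintegral_enorm_iteratedFDeriv_dilate_le [MeasurableSpace G] (μ : Measure G)
    (A : G →L[ℝ] E) (p j : ℕ) {δ M : ℝ} {T : Set G}
    (hM : ∀ x, ‖iteratedFDeriv ℝ j (dilate χ h A p δ) x‖ ≤ M)
    (hT : tsupport χ ∩ {x | δ⁻¹ • A x ∈ tsupport h} ⊆ T) (hTm : MeasurableSet T) :
    ∫⁻ x, ‖iteratedFDeriv ℝ j (dilate χ h A p δ) x‖ₑ ^ 2 ∂μ ≤ ENNReal.ofReal (M ^ 2) * μ T := by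
  have hpt (x : G) : ‖iteratedFDeriv ℝ j (dilate χ h A p δ) x‖ₑ ^ 2 ≤
      T.indicator (fun _ => ENNReal.ofReal (M ^ 2)) x := by
    by_cases hx : iteratedFDeriv ℝ j (dilate χ h A p δ) x = 0
    · rw [hx, ← ofReal_norm, norm_zero]
      simp
    · have hxT : x ∈ T :=
        hT (tsupport_dilate_subset χ h A p δ (support_iteratedFDeriv_subset j hx))
      rw [Set.indicator_of_mem hxT, ← ofReal_norm, ← ENNReal.ofReal_pow (norm_nonneg _)]
      exact ENNReal.ofReal_le_ofReal (pow_le_pow_left₀ (norm_nonneg _) (hM x) 2)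
  refine (lintegral_mono hpt).trans (le_of_eq ?_)
  rw [lintegral_indicator hTm, setLIntegral_const]

end dilate

theorem exists_subset_tube {d K : ℕ} {χ h : Config d (K + 1) → ℂ} (hχ : HasCompactSupport χ)
    (hh : HasCompactSupport h) : ∃ R ρ : ℝ, 0 ≤ ρ ∧ ∀ δ : ℝ, 0 < δ →
      tsupport χ ∩ {x | δ⁻¹ • relative d K x ∈ tsupport h} ⊆ tube d K R (ρ * δ) := by
  obtain ⟨R, hR⟩ := hχ.isCompact.isBounded.exists_norm_le
  obtain ⟨ρ, hρ⟩ := hh.isCompact.isBounded.exists_norm_le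
  refine ⟨R, |ρ|, abs_nonneg _, fun δ hδ x ⟨hx1, hx2⟩ => ⟨(PiLp.norm_apply_le x 0).trans (hR x hx1),
    fun j => ?_⟩⟩
  have h1 := (PiLp.norm_apply_le (δ⁻¹ • relative d K x) j).trans
    ((hρ _ hx2).trans (le_abs_self ρ))
  rw [PiLp.smul_apply, relative_apply, norm_smul, Real.norm_eq_abs, abs_of_pos (inv_pos.2 hδ),
    inv_mul_le_iff₀ hδ] at h1
  linarith

/-- The central scaling estimate: squared derivatives of order at most `m` are `O(δ^(2 p - 2 m))`,
and they live in a tube of volume `O(δ^(d K))`. -/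
theorem exists_sobolevNormSq_dilate_lt {d K : ℕ} {χ h : Config d (K + 1) → ℂ}
    (hχ : ContDiff ℝ ∞ χ) (hχc : HasCompactSupport χ) (hh : ContDiff ℝ ∞ h)
    (hc : HasCompactSupport h) {p m : ℕ} (hm : 0 < m) (hlt : 2 * m < 2 * p + d * K)
    {ε : ℝ≥0∞} (hε : 0 < ε) :
    ∃ δ : ℝ, 0 < δ ∧ sobolevNormSq (m : ℝ) ((memLp_of_smooth_compactSupport
      (contDiff_dilate hχ hh (relative d K) p δ)
      (hasCompactSupport_dilate hχc h (relative d K) p δ)).toLp _) < ε := by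
  obtain ⟨C₁, hC₁, hsob⟩ := exists_sobolevNormSq_le d (K + 1) (s := m) (m := m)
    (by exact_mod_cast hm) le_rfl
  obtain ⟨B, hB, hD⟩ := exists_norm_iteratedFDeriv_dilate_le hχ hχc hh hc (relative d K) p m
  obtain ⟨R, ρ, hρ, hsub⟩ := exists_subset_tube hχc hc
  obtain ⟨C₂, hC₂, hvol⟩ := exists_volume_tube_le d K R
  -- The surplus `e + 1` is the power of `δ` left after the negative powers cancel; being at least
  -- 1, it forces convergence to 0.
  obtain ⟨e, he⟩ : ∃ e, 2 * p + d * K = 2 * m + (e + 1) := ⟨2 * p + d * K - 2 * m - 1, by omega⟩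
  let C₃ : ℝ≥0∞ := C₁ * (2 * C₂)
  let c : ℝ := B ^ 2 * ρ ^ (d * K)
  have hC₃ : C₃ ≠ ⊤ := by simp only [C₃]; finiteness
  have hbound (δ : ℝ) (hδ : 0 < δ) (hδ1 : δ ≤ 1) (j : ℕ) (hj : j ≤ m) :
      ∫⁻ x, ‖iteratedFDeriv ℝ j (dilate χ h (relative d K) p δ) x‖ₑ ^ 2 ≤
        C₂ * ENNReal.ofReal (c * δ ^ (e + 1)) := by
    refine (lintegral_enorm_iteratedFDeriv_dilate_le volume (relative d K) p j (hD δ hδ hδ1 j hj)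
      (hsub δ hδ) (measurableSet_tube d K R (ρ * δ))).trans ?_
    refine (mul_le_mul_right (hvol (ρ * δ) (by positivity)) _).trans (le_of_eq ?_)
    rw [mul_left_comm, ← ENNReal.ofReal_mul (by positivity)]
    congr 2
    have h1 : δ ^ (2 * p + d * K) = δ ^ (2 * m) * δ ^ (e + 1) := by rw [he, pow_add]
    simp only [c]
    calc _ = B ^ 2 * ρ ^ (d * K) * (δ ^ (2 * p + d * K) * (δ⁻¹) ^ (2 * m)) := by ring
      _ = B ^ 2 * ρ ^ (d * K) * δ ^ (e + 1) * (δ ^ (2 * m) * (δ⁻¹) ^ (2 * m)) := by rw [h1]; ring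
      _ = _ := by rw [← mul_pow, mul_inv_cancel₀ hδ.ne', one_pow, mul_one]
  have htend : Filter.Tendsto (fun δ : ℝ => C₃ * ENNReal.ofReal (c * δ ^ (e + 1)))
      (nhdsWithin 0 (Set.Ioi 0)) (nhds 0) := by
    have h1 : Filter.Tendsto (fun δ : ℝ => ENNReal.ofReal (c * δ ^ (e + 1)))
        (nhdsWithin 0 (Set.Ioi 0)) (nhds (ENNReal.ofReal (c * 0 ^ (e + 1)))) := by
      refine Filter.Tendsto.mono_left (Continuous.tendsto ?_ 0) nhdsWithin_le_nhds
      exact ENNReal.continuous_ofReal.comp (by fun_prop)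
    have h2 := ENNReal.Tendsto.const_mul h1 (Or.inr hC₃)
    simpa using h2
  have hev := htend.eventually (gt_mem_nhds hε)
  have h1 : ∀ᶠ δ : ℝ in nhdsWithin 0 (Set.Ioi 0), δ ≤ 1 :=
    (eventually_le_nhds one_pos).filter_mono nhdsWithin_le_nhds
  obtain ⟨δ, ⟨hlt, hδ1⟩, hδ⟩ := ((hev.and h1).and self_mem_nhdsWithin).exists
  refine ⟨δ, hδ, lt_of_le_of_lt ?_ hlt⟩
  refine (hsob _ (contDiff_dilate hχ hh (relative d K) p δ)
    (hasCompactSupport_dilate hχc h (relative d K) p δ) _).trans ?_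
  have h0 := hbound δ hδ hδ1 0 (Nat.zero_le _)
  have hm' := hbound δ hδ hδ1 m le_rfl
  have e0 : ∫⁻ x, ‖iteratedFDeriv ℝ 0 (dilate χ h (relative d K) p δ) x‖ₑ ^ 2 =
      ∫⁻ x, ‖dilate χ h (relative d K) p δ x‖ₑ ^ 2 := by
    refine lintegral_congr fun x => ?_
    rw [← ofReal_norm, norm_iteratedFDeriv_zero, ofReal_norm]
  rw [e0] at h0
  simp only [C₃, mul_assoc]
  gcongr
  exact (add_le_add h0 hm').trans_eq (two_mul _).symm

/-! ### Integrability against the potential. -/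

/-- The sum of the squared distances of all pairs of particles. -/
def pairSum {d N : ℕ} (x : Config d N) : ℝ := ∑ j, ∑ l with j < l, ‖x j - x l‖ ^ 2

theorem norm_sub_le_sqrt_pairSum {d N : ℕ} (x : Config d N) (j l : Fin N) :
    ‖x j - x l‖ ≤ √(pairSum x) := by
  refine Real.le_sqrt_of_sq_le ?_
  have key {j l : Fin N} (h : j < l) : ‖x j - x l‖ ^ 2 ≤ pairSum x :=
    (Finset.single_le_sum (f := fun l => ‖x j - x l‖ ^ 2) (fun _ _ => by positivity)
      (by simpa using h)).trans
      (Finset.single_le_sum (f := fun j => ∑ l with j < l, ‖x j - x l‖ ^ 2)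
        (fun _ _ => Finset.sum_nonneg fun _ _ => by positivity) (Finset.mem_univ j))
  rcases lt_trichotomy j l with h | h | h
  · exact key h
  · subst h
    simpa [pairSum] using Finset.sum_nonneg fun _ _ => Finset.sum_nonneg fun _ _ => by positivity
  · rw [norm_sub_rev]
    exact key h

theorem potential_self {d N : ℕ} (m : ℕ) (x : Config d N) :
    potential N (m : ℝ) x = ((ENNReal.ofReal (pairSum x)) ^ m)⁻¹ := by
  have : Finset.powersetCard N (Finset.univ : Finset (Fin N)) = {Finset.univ} := by
    simpa using Finset.powersetCard_self (Finset.univ : Finset (Fin N))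
  rw [potential, this, Finset.sum_singleton, ENNReal.rpow_neg, ENNReal.rpow_natCast]
  rfl

theorem inv_pow_mul_sq_enorm_le {S r : ℝ} {m p : ℕ} {z : ℂ} {a : ℝ} (ha : 0 < a)
    (haS : a ^ 2 ≤ S) (hz : ‖z‖ ≤ r ^ p) :
    ((ENNReal.ofReal S) ^ m)⁻¹ * ‖z‖ₑ ^ 2 ≤ ENNReal.ofReal ((a ^ (2 * m))⁻¹ * r ^ (2 * p)) := by
  have hS : 0 < S := (by positivity : 0 < a ^ 2).trans_le haS
  rw [← ENNReal.ofReal_pow hS.le, ← ENNReal.ofReal_inv_of_pos (by positivity), ← ofReal_norm,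
    ← ENNReal.ofReal_pow (norm_nonneg _), ← ENNReal.ofReal_mul (by positivity)]
  refine ENNReal.ofReal_le_ofReal ?_
  rw [pow_mul, mul_comm 2 p, pow_mul]
  gcongr

/-- Write `r = √(pairSum x)`. Then `W = r^(-2 m)` and `|u|² ≤ r^(2 p)`, while the shell `r ~ 2^(-n)`
within the support of `χ` has volume `O(2^(-n d K))`. The shells contribute a convergent geometric
series; for `r ≥ 1` the weight is at most 1. -/
theorem lintegral_potential_mul_lt_top {d K : ℕ} [NeZero d] (hK : 0 < K) {m : ℕ}
    (hlt : 2 * m < 2 * numPairs (K + 1) + d * K) {χ : Config d (K + 1) → ℂ}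
    (hχ : ContDiff ℝ ∞ χ) (hχc : HasCompactSupport χ) (hχ1 : ∀ x, ‖χ x‖ ≤ 1) :
    ∫⁻ x, potential (K + 1) (m : ℝ) x * ‖χ x * differenceProduct x‖ₑ ^ 2 < ⊤ := by
  obtain ⟨R, hR⟩ := hχc.isCompact.isBounded.exists_norm_le
  obtain ⟨C, hC, hvol⟩ := exists_volume_tube_le d K R
  obtain ⟨e, he⟩ : ∃ e, 2 * numPairs (K + 1) + d * K = 2 * m + (e + 1) :=
    ⟨2 * numPairs (K + 1) + d * K - 2 * m - 1, by omega⟩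
  generalize hp : numPairs (K + 1) = p at he
  -- The inner radius of the shell bounds `W`, the outer one bounds `|u|²`; the mismatch costs the
  -- factor `2^(2 m)` below.
  let w : ℕ → ℝ := fun n => (((1 / 2 : ℝ) ^ (n + 1)) ^ (2 * m))⁻¹ * ((1 / 2) ^ n) ^ (2 * p)
  let f : ℕ → Config d (K + 1) → ℝ≥0∞ := fun n =>
    (tube d K R ((1 / 2) ^ n)).indicator fun _ => ENNReal.ofReal (w n)
  have hpt (x : Config d (K + 1)) :
      potential (K + 1) (m : ℝ) x * ‖χ x * differenceProduct x‖ₑ ^ 2 ≤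
        ‖χ x * differenceProduct x‖ₑ ^ 2 + ∑' n, f n x := by
    rw [potential_self]
    have hu : ‖χ x * differenceProduct x‖ ≤ √(pairSum x) ^ p := by
      rw [norm_mul, ← one_mul (_ ^ p), ← hp]
      exact mul_le_mul (hχ1 x) (norm_differenceProduct_le (norm_sub_le_sqrt_pairSum x))
        (norm_nonneg _) zero_le_one
    by_cases hx0 : χ x = 0
    · simp [hx0]
    rcases le_or_gt 1 (pairSum x) with h1 | h1
    · refine le_trans ?_ le_self_add
      refine mul_le_of_le_one_left (zero_le) (ENNReal.inv_le_one.2 ?_)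
      exact one_le_pow₀ (by simpa using h1)
    rcases (Real.sqrt_nonneg (pairSum x)).eq_or_lt with h0 | h0
    -- On the diagonal `W = ∞`, but `u = 0` there and `∞ * 0 = 0` in `ℝ≥0∞`.
    · have : differenceProduct x = 0 := by
        refine differenceProduct_eq_zero (i := 0) (j := Fin.last K) (Fin.lt_def.2 hK) ?_
        have := norm_sub_le_sqrt_pairSum x 0 (Fin.last K)
        rw [← h0] at this
        exact sub_eq_zero.1 (norm_le_zero_iff.1 this)
      simp [this]
    obtain ⟨n, hn1, hn2⟩ := exists_nat_pow_near_of_lt_one (y := (1 / 2 : ℝ)) h0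
      (Real.sqrt_le_one.2 h1.le) (by norm_num) (by norm_num)
    have hmem : x ∈ tube d K R ((1 / 2) ^ n) :=
      ⟨(PiLp.norm_apply_le x 0).trans (hR x (subset_tsupport _ hx0)),
        fun j => (norm_sub_le_sqrt_pairSum x j 0).trans hn2⟩
    have hfn : f n x = ENNReal.ofReal (w n) := Set.indicator_of_mem hmem _
    refine le_trans ?_ ((ENNReal.le_tsum n).trans le_add_self)
    rw [hfn]
    refine inv_pow_mul_sq_enorm_le (by positivity) ?_
      (hu.trans (pow_le_pow_left₀ h0.le hn2 p))
    rw [← Real.sq_sqrt (Real.sqrt_pos.1 h0).le]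
    exact pow_le_pow_left₀ (by positivity) hn1.le 2
  have hf (n : ℕ) : ∫⁻ x, f n x ≤ ENNReal.ofReal (2 ^ (2 * m)) * C * ENNReal.ofReal (1 / 2) ^ n := by
    simp only [f]
    rw [lintegral_indicator (measurableSet_tube _ _ _ _), setLIntegral_const]
    refine (mul_le_mul_right (hvol _ (by positivity)) _).trans ?_
    rw [mul_left_comm, mul_comm (ENNReal.ofReal (2 ^ (2 * m))) C, mul_assoc,
      ← ENNReal.ofReal_mul (by positivity), ← ENNReal.ofReal_pow (by norm_num),
      ← ENNReal.ofReal_mul (by positivity)]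
    refine mul_le_mul_right (ENNReal.ofReal_le_ofReal ?_) C
    have h1 : w n * ((1 / 2) ^ n) ^ (d * K) = 2 ^ (2 * m) * ((1 / 2) ^ n) ^ (e + 1) := by
      have h2 : ((1 / 2 : ℝ) ^ n) ^ (2 * p) * ((1 / 2) ^ n) ^ (d * K) =
          ((1 / 2) ^ n) ^ (2 * m) * ((1 / 2) ^ n) ^ (e + 1) := by
        rw [← pow_add, ← pow_add, he]
      simp only [w]
      rw [mul_assoc, h2, pow_succ, mul_pow]
      have h3 : ((1 / 2 : ℝ) ^ n) ^ (2 * m) ≠ 0 := by positivity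
      rw [mul_inv, one_div, inv_pow 2 (2 * m), inv_inv]
      rw [one_div] at h3
      field_simp
    rw [h1, pow_succ]
    refine mul_le_mul_of_nonneg_left ?_ (by positivity)
    refine mul_le_of_le_one_left (by positivity) ?_
    exact pow_le_one₀ (by positivity) (pow_le_one₀ (by norm_num) (by norm_num))
  have hg : Measurable fun x => ‖χ x * differenceProduct x‖ₑ ^ 2 :=
    ((hχ.mul contDiff_differenceProduct).continuous.enorm.measurable).pow_const 2
  refine (lintegral_mono hpt).trans_lt ?_
  rw [lintegral_add_left hg, lintegral_tsum fun n =>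
    (measurable_const.indicator (measurableSet_tube _ _ _ _)).aemeasurable]
  refine ENNReal.add_lt_top.2 ⟨lintegral_enorm_sq_lt_top _
    (hχ.mul contDiff_differenceProduct).continuous hχc.mul_right, ?_⟩
  refine (ENNReal.tsum_le_tsum hf).trans_lt ?_
  rw [ENNReal.tsum_mul_left, ENNReal.tsum_geometric]
  have : 1 - ENNReal.ofReal (1 / 2) ≠ 0 := by
    refine (tsub_pos_of_lt ?_).ne'
    rw [← ENNReal.ofReal_one]
    exact (ENNReal.ofReal_lt_ofReal_iff one_pos).2 (by norm_num)
  exact ENNReal.mul_lt_top (by finiteness) (ENNReal.inv_lt_top.2 (pos_iff_ne_zero.2 this))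

/-! ### Hard-core approximation and the case of exactly `k` particles. -/

theorem toLp_mem_hardCoreSpace {d K : ℕ} [NeZero d] {m : ℕ} (hm : 0 < m)
    (hlt : 2 * m < 2 * numPairs (K + 1) + d * K) {χ : Config d (K + 1) → ℂ}
    (hχ : ContDiff ℝ ∞ χ) (hχc : HasCompactSupport χ)
    (hmem : MemLp (fun x => χ x * differenceProduct x) 2 (volume : Measure (Config d (K + 1)))) :
    hmem.toLp _ ∈ hardCoreSpace d (K + 1) (K + 1) (m : ℝ) := by
  have hu : ContDiff ℝ ∞ (differenceProduct : Config d (K + 1) → ℂ) := contDiff_differenceProduct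
  refine ⟨toLp_mem_sobolevSpace (by exact_mod_cast hm) (hχ.mul hu) hχc.mul_right hmem,
    fun ε hε => ?_⟩
  let b : ContDiffBump (0 : Config d (K + 1)) := ⟨1, 2, one_pos, one_lt_two⟩
  let h : Config d (K + 1) → ℂ := fun y => differenceProduct y * (b y : ℂ)
  have hb : ContDiff ℝ ∞ fun y => (b y : ℂ) := Complex.ofRealCLM.contDiff.comp b.contDiff
  have hbc : HasCompactSupport fun y => (b y : ℂ) :=
    b.hasCompactSupport.comp_left (g := fun t : ℝ => (t : ℂ)) (by simp)
  have hh : ContDiff ℝ ∞ h := hu.mul hb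
  have hc : HasCompactSupport h := hbc.mul_left
  obtain ⟨δ, hδ, hlt⟩ := exists_sobolevNormSq_dilate_lt hχ hχc hh hc hm hlt hε
  let ψ := dilate χ h (relative d K) (numPairs (K + 1)) δ
  -- By homogeneity and translation invariance of `u`, the dilate of the fixed profile `u b` is `χ
  -- u` localized at scale `δ` around the diagonal. Subtracting it leaves a function supported off
  -- the diagonal.
  have hψ (x : Config d (K + 1)) :
      ψ x = χ x * differenceProduct x * (b (δ⁻¹ • relative d K x) : ℂ) := by
    have h1 : differenceProduct (δ⁻¹ • relative d K x) =
        ((δ : ℂ) ^ numPairs (K + 1))⁻¹ * differenceProduct x := by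
      rw [differenceProduct_smul, differenceProduct_relative]
      push_cast
      rw [inv_pow]
    have h2 : (δ : ℂ) ^ numPairs (K + 1) ≠ 0 := pow_ne_zero _ (by exact_mod_cast hδ.ne')
    simp only [ψ, dilate, h]
    rw [h1]
    field_simp
  have hψs : ContDiff ℝ ∞ ψ := contDiff_dilate hχ hh _ _ _
  have hψc : HasCompactSupport ψ := hasCompactSupport_dilate hχc _ _ _ _
  have hψm := memLp_of_smooth_compactSupport hψs hψc
  refine ⟨(fun x => χ x * differenceProduct x) - ψ, (hχ.mul hu).sub hψs,
    HasCompactSupport.sub hχc.mul_right hψc, ?_, hmem.sub hψm, ?_⟩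
  · rintro x hx ⟨A, hA, hAx⟩
    -- With `N = k` the only coincidence is the total one. There the relative positions vanish, and
    -- `b = 1` near 0, so `χ u - ψ` vanishes in a whole neighbourhood.
    have hA' : A = Finset.univ := by
      rw [← Finset.card_eq_iff_eq_univ, hA, Fintype.card_fin]
    have hx0 : relative d K x = 0 := by
      ext1 j
      rw [relative_apply, hAx j (by simp [hA']) 0 (by simp [hA']), sub_self]
      rfl
    refine absurd hx (notMem_tsupport_iff_eventuallyEq.2 ?_)
    have hcont : ContinuousAt (fun x => δ⁻¹ • relative d K x) x :=
      ((relative d K).continuous.const_smul δ⁻¹).continuousAt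
    have hev : ∀ᶠ y in nhds (δ⁻¹ • relative d K x), b y = 1 := by
      rw [hx0, smul_zero]
      exact b.eventuallyEq_one
    filter_upwards [hcont.eventually hev] with y hy
    simp [hψ, hy]
  · rw [MemLp.toLp_sub hmem hψm, sub_sub_cancel]
    exact hlt

theorem isCounterexample_differenceProduct {d K m : ℕ} [NeZero d] {Ω : Set (Pt d)}
    (hΩ_open : IsOpen Ω) (hΩ_nonempty : Ω.Nonempty) (hΩ_bounded : Bornology.IsBounded Ω)
    (hK : 0 < K) (hKm : K < m) (hlt : 2 * m < 2 * numPairs (K + 1) + d * K) :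
    IsCounterexample (K + 1) (m : ℝ) Ω (differenceProduct : Config d (K + 1) → ℂ) := by
  have hu : ContDiff ℝ ∞ (differenceProduct : Config d (K + 1) → ℂ) := contDiff_differenceProduct
  obtain ⟨χ, hχ, hχc, hχ1, hχle⟩ := exists_cutoff d (K + 1) hΩ_bounded
  have hmem : MemLp (fun x => χ x * differenceProduct x) 2 (volume : Measure (Config d (K + 1))) :=
    memLp_of_smooth_compactSupport (hχ.mul hu) hχc.mul_right
  have hm : 0 < m := by omega
  obtain ⟨z, hz, hz0⟩ := exists_box_differenceProduct_ne_zero (K + 1) hΩ_open hΩ_nonempty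
  refine ⟨⟨hu.contDiffOn, ?_⟩, ⟨hu.contDiffOn, hmem.toLp _,
    ⟨toLp_mem_hardCoreSpace hm hlt hχ hχc hmem,
      toLp_mem_sobolevSpace (by exact_mod_cast hm) (hχ.mul hu) hχc.mul_right hmem, ?_⟩, ?_⟩,
    boxNorm_ne_zero hΩ_open hu.continuous hz hz0, boxNorm_ne_top hΩ_bounded hΩ_open hu,
    manySeminorm_eq_zero fun j x' => ?_⟩
  · rintro x ⟨-, A, hA, hAx⟩
    have hA' : A = Finset.univ := by
      rw [← Finset.card_eq_iff_eq_univ, hA, Fintype.card_fin]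
    exact differenceProduct_eq_zero (i := 0) (j := Fin.last K) (Fin.lt_def.2 hK)
      (hAx _ (by simp [hA']) _ (by simp [hA']))
  · refine lt_of_eq_of_lt (lintegral_congr_ae ?_)
      (lintegral_potential_mul_lt_top hK hlt hχ hχc hχle)
    filter_upwards [hmem.coeFn_toLp] with x hx
    rw [hx]
  · filter_upwards [ae_restrict_of_ae hmem.coeFn_toLp,
      ae_restrict_mem (isOpen_box hΩ_open).measurableSet] with x hx hxb
    rw [hx, hχ1 x hxb, one_mul]
  · obtain ⟨q, hq, he⟩ := exists_eval_differenceProduct_insertAt j x'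
    rw [he]
    exact seminormSq_eval_eq_zero m Ω (Polynomial.degreeLT_mono hKm hq)

end ManyBody

end

theorem proposition9 (d k : ℕ) [NeZero d] (hk : 2 ≤ k) (Ω : Set (EuclideanSpace ℝ (Fin d)))
    (hΩ_open : IsOpen Ω) (hΩ_nonempty : Ω.Nonempty) (hΩ_bounded : Bornology.IsBounded Ω) :
    (∀ (N : ℕ) (s : ℝ), N < k → 0 < s →
      ¬ ManyBody.PoincareInequality s Ω (ManyBody.vanishingClass N k Ω) ∧
      ¬ ManyBody.PoincareInequality s Ω
        (ManyBody.restrictionClass Ω (ManyBody.hardCoreSpace d N k s)) ∧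
      ¬ ManyBody.PoincareInequality s Ω
        (ManyBody.restrictionClass Ω (ManyBody.potentialSpace d N k s)) ∧
      ManyBody.IsCounterexample k s Ω (fun _ : ManyBody.Config d N => (1 : ℂ))) ∧
    (∀ (N : ℕ) (s : ℝ) (m : ℕ), N = k → s = m →
      max (d : ℝ) 2 * ((k : ℝ) - 1) < 2 * s → 2 * s < ((d : ℝ) + k) * ((k : ℝ) - 1) →
      ¬ ManyBody.PoincareInequality s Ω (ManyBody.vanishingClass N k Ω) ∧
      ¬ ManyBody.PoincareInequality s Ω
        (ManyBody.restrictionClass Ω (ManyBody.hardCoreSpace d N k s)) ∧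
      ¬ ManyBody.PoincareInequality s Ω
        (ManyBody.restrictionClass Ω (ManyBody.potentialSpace d N k s)) ∧
      ManyBody.IsCounterexample k s Ω
        (ManyBody.differenceProduct : ManyBody.Config d N → ℂ)) := by
  refine ⟨fun N s hN hs => ?_, fun N s m hN hsm h1 h2 => ?_⟩
  · have h := ManyBody.isCounterexample_one hΩ_open hΩ_nonempty hΩ_bounded hN hs
    obtain ⟨ha, hb, hc⟩ := h.not_poincareInequality
    exact ⟨ha, hb, hc, h⟩
  · subst hN hsm
    obtain ⟨K, rfl⟩ : ∃ K, N = K + 1 := ⟨N - 1, by omega⟩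
    have hK : 0 < K := by omega
    push_cast at h1 h2
    rw [add_sub_cancel_right] at h1 h2
    have hKm : K < m := by
      have h3 : 2 * (K : ℝ) ≤ max (d : ℝ) 2 * K :=
        mul_le_mul_of_nonneg_right (le_max_right _ _) (Nat.cast_nonneg K)
      have h4 : (K : ℝ) < m := by linarith
      exact_mod_cast h4
    -- `(d + k) (k - 1) = K (K + 1) + d K`, and `K (K + 1)` is twice the degree of the difference
    -- product.
    have hlt : 2 * m < 2 * ManyBody.numPairs (K + 1) + d * K := by
      rw [ManyBody.two_mul_numPairs]
      have h3 : (2 * m : ℝ) < K * (K + 1) + d * K := by linarith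
      exact_mod_cast h3
    have h := ManyBody.isCounterexample_differenceProduct hΩ_open hΩ_nonempty hΩ_bounded hK hKm hlt
    obtain ⟨ha, hb, hc⟩ := h.not_poincareInequality
    exact ⟨ha, hb, hc, h⟩
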